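/- Let $\delta,\lambda,L_0,A_0\in\mathbb{R}$ with $\lambda>0$, $L_0>0$ and $-\frac{L_0^2}{4\pi}\le A_0\le \frac{L_0^2}{4\pi}$. Let $H^1_{per}$ be the set of (continuous representatives of) functions $\eta\in H^1([0,2\pi];\mathbb{R}^2)$ with $\eta(0)=\eta(2\pi)$. Let $H^2_{imm}$ be the set of ($C^1$ representatives of) curves $\gamma\in H^2([0,2\pi];\mathbb{R}^2)$ with $\partial_x\gamma(x)\neq 0$ for all $x\in[0,2\pi]$, $\gamma(0)=\gamma(2\pi)$ and $\partial_x\gamma(0)=\partial_x\gamma(2\pi)$. Let $J$ be the counterclockwise rotation of $\mathbb{R}^2$ by $\pi/2$. For $\gamma\in H^2_{imm}$ and $\eta\in H^1_{per}$ put $$\int_\gamma f\,ds=\int_0^{2\pi} f\,|\partial_x\gamma|\,dx,\qquad \partial_s=|\partial_x\gamma|^{-1}\partial_x,\qquad \tau=\partial_s\gamma,\qquad \nu=J\tau,$$ let the curvature $\kappa$ be defined by $\partial_s\tau=\kappa\nu$, let $\operatorname{div}_\gamma\eta=\langle\partial_s\eta,\tau\rangle$ and $\nabla_\gamma\eta=\partial_s\eta\otimes\tau$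 (with the Frobenius norm), and let $$L(\gamma)=\int_0^{2\pi}|\partial_x\gamma|\,dx,\qquad A(\gamma)=-\frac12\int_0^{2\pi}\langle\gamma,J\partial_x\gamma\rangle\,dx,$$ $$E(\gamma,\eta)=\frac12\int_\gamma(\kappa+\delta\operatorname{div}_\gamma\eta)^2\,ds+\frac{\lambda}{2}\int_\gamma|\nabla_\gamma\eta|^2\,ds .$$ Then the variational problem of minimizing $E$ in $$\mathcal{A}=\{(\gamma,\eta)\in H^2_{imm}\times H^1_{per}\colon L(\gamma)=L_0,\ A(\gamma)=A_0,\ |\eta|^2=1 \text{ on } [0,2\pi]\}$$ has a solution, that is, there exists $(\gamma^*,\eta^*)\in\mathcal{A}$ with $E(\gamma^*,\eta^*)\le E(\gamma,\eta)$ for all $(\gamma,\eta)\in\mathcal{A}$. -/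

import Mathlib

open scoped ContDiff

noncomputable section

namespace SurfactantCurve

/-- The Euclidean plane `ℝ²`. -/
abbrev Plane : Type := EuclideanSpace ℝ (Fin 2)

/-- The closed parameter interval `[0, 2π]`. -/
def paramInterval : Set ℝ := Set.Icc 0 (2 * Real.pi)

/-- Lebesgue measure on the open interval `(0, 2π)`. -/
def paramMeasure : MeasureTheory.Measure ℝ :=
  MeasureTheory.volume.restrict (Set.Ioo 0 (2 * Real.pi))

/-- `g` is a weak derivative of `u` on `(0, 2π)`: integration by parts against every test function
`φ ∈ C_c^∞((0, 2π))`. It is only used for `u` and `g` that are square integrable on `(0, 2π)`. -/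
def IsWeakDeriv (u g : ℝ → Plane) : Prop :=
  ∀ φ : ℝ → ℝ, ContDiff ℝ ∞ φ → HasCompactSupport φ → tsupport φ ⊆ Set.Ioo 0 (2 * Real.pi) →
    ∫ x in (0 : ℝ)..(2 * Real.pi), deriv φ x • u x =
      -∫ x in (0 : ℝ)..(2 * Real.pi), φ x • g x

/-- Membership in the Sobolev space `H^k((0, 2π); ℝ²)`: `u` and its weak derivatives up to
order `k` are square integrable. -/
def MemH : ℕ → (ℝ → Plane) → Prop
  | 0, u => MeasureTheory.MemLp u 2 paramMeasure
  | k + 1, u => MeasureTheory.MemLp u 2 paramMeasure ∧ ∃ g, IsWeakDeriv u g ∧ MemH k g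

open Classical in
/-- A square integrable weak derivative of `u` (unique up to null sets), if there is one. -/
def weakDeriv (u : ℝ → Plane) : ℝ → Plane :=
  if h : ∃ g, MeasureTheory.MemLp g 2 paramMeasure ∧ IsWeakDeriv u g then h.choose else 0

/-- The classical derivative `∂ₓγ` on `[0, 2π]`, one-sided at the end points. -/
def dx (γ : ℝ → Plane) (x : ℝ) : Plane := derivWithin γ paramInterval x

/-- The space `H¹_per([0, 2π]; ℝ²)`; its elements are given by their continuous representatives.
Values outside `[0, 2π]` are irrelevant. -/
def HPer1 : Set (ℝ → Plane) :=
  {η | ContinuousOn η paramInterval ∧ MemH 1 η ∧ η 0 = η (2 * Real.pi)}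

/-- The set `H²_imm([0, 2π]; ℝ²)` of regular closed curves of class `H²`, given by their `C¹`
representatives. Values outside `[0, 2π]` are irrelevant. -/
def HImm2 : Set (ℝ → Plane) :=
  {γ | ContDiffOn ℝ 1 γ paramInterval ∧ MemH 2 γ ∧ (∀ x ∈ paramInterval, dx γ x ≠ 0) ∧
    γ 0 = γ (2 * Real.pi) ∧ dx γ 0 = dx γ (2 * Real.pi)}

/-- The counterclockwise rotation of the plane by `π / 2`. -/
def rot (v : Plane) : Plane := !₂[-v 1, v 0]

/-- `∫_γ f ds`. -/
def curveIntegral (γ : ℝ → Plane) (f : ℝ → ℝ) : ℝ :=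
  ∫ x in (0 : ℝ)..(2 * Real.pi), f x * ‖dx γ x‖

/-- The length `L(γ)`. -/
def length (γ : ℝ → Plane) : ℝ := ∫ x in (0 : ℝ)..(2 * Real.pi), ‖dx γ x‖

/-- The enclosed signed area `A(γ)`. -/
def area (γ : ℝ → Plane) : ℝ :=
  -(1 / 2) * ∫ x in (0 : ℝ)..(2 * Real.pi), inner ℝ (γ x) (rot (dx γ x))

/-- The mapping `S(η) = |η|² - 1`. -/
def unitDefect (η : ℝ → Plane) (x : ℝ) : ℝ := ‖η x‖ ^ 2 - 1

/-- The unit tangent `τ = ∂ₓγ / |∂ₓγ|`. -/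
def tangent (γ : ℝ → Plane) (x : ℝ) : Plane := ‖dx γ x‖⁻¹ • dx γ x

/-- The unit normal `ν = Jτ`. -/
def normal (γ : ℝ → Plane) (x : ℝ) : Plane := rot (tangent γ x)

/-- The arc length derivative `∂ₛη = |∂ₓγ|⁻¹ ∂ₓη` along `γ` of an `H¹` vector field `η`. -/
def arcDeriv (γ η : ℝ → Plane) (x : ℝ) : Plane := ‖dx γ x‖⁻¹ • weakDeriv η x

/-- The oriented curvature `κ`, that is, the coefficient in `∂ₛτ = κν`. -/
def curvature (γ : ℝ → Plane) (x : ℝ) : ℝ := inner ℝ (arcDeriv γ (tangent γ) x) (normal γ x)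

/-- The divergence `div_γ η = ⟨∂ₛη, τ⟩`. -/
def divergence (γ η : ℝ → Plane) (x : ℝ) : ℝ := inner ℝ (arcDeriv γ η x) (tangent γ x)

/-- The gradient `∇_γ η = ∂ₛη ⊗ τ`, whose rows are the gradients of the components of `η`. -/
def gradient (γ η : ℝ → Plane) (x : ℝ) : Matrix (Fin 2) (Fin 2) ℝ :=
  Matrix.of fun i j => arcDeriv γ η x i * tangent γ x j

/-- The square `|M|²` of the Euclidean (Frobenius) norm of a matrix. -/
def normSq (M : Matrix (Fin 2) (Fin 2) ℝ) : ℝ := ∑ i, ∑ j, M i j ^ 2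

/-- The energy `E(γ, η) = ½ ∫_γ (κ + δ div_γ η)² ds + (λ/2) ∫_γ |∇_γ η|² ds`. -/
def energy (δ lam : ℝ) (γ η : ℝ → Plane) : ℝ :=
  1 / 2 * curveIntegral γ (fun x => (curvature γ x + δ * divergence γ η x) ^ 2) +
    lam / 2 * curveIntegral γ (fun x => normSq (gradient γ η x))

/-- The pairs `(γ, η) ∈ H²_imm × H¹_per` with `L(γ) = L₀`, `A(γ) = A₀` and `S(η) = 0`. -/
def admissible (L₀ A₀ : ℝ) : Set ((ℝ → Plane) × (ℝ → Plane)) :=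
  {p | p.1 ∈ HImm2 ∧ p.2 ∈ HPer1 ∧ length p.1 = L₀ ∧ area p.1 = A₀ ∧
    ∀ x ∈ paramInterval, unitDefect p.2 x = 0}

end SurfactantCurve

end

open scoped ContDiff

noncomputable section

namespace SurfactantCurve

open MeasureTheory Set Filter Topology

/-! ### Absolutely continuous vector valued functions -/

section AbsolutelyContinuous

variable {E : Type*} [NormedAddCommGroup E] [NormedSpace ℝ E]

/-! The proof is the direct method, carried out after the parametrization has been normalized.
Length and energy do not depend on the parametrization, so with `c = L₀ / (2π)` every admissible
pair can be replaced by its constant speed version, described by the unit tangent `T`, the director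
`N` and their derivatives `p`, `q` in `L²`. The curve is recovered as `c ∫ T`, which also removes
translations. `exists_tangentDirector_of_admissible` and `exists_admissible_of_tangentDirector` are
the two directions of this dictionary; both preserve the energy, which becomes `(1/2c) ∫ b² + (λ/2c)
∫ |q|²` with `b = ⟨p, JT⟩ + δ⟨q, T⟩`.

Coercivity: since `λ > 0`, the energy bounds `q` and `b` in `L²`; since `|T| = 1`, `p` is normal to
`T`, so `|p| = |b - δ⟨q, T⟩|` is bounded as well (`energy_bounds`).

Compactness: a subsequence has `p`, `q` weakly convergent in `L²` and `T(0)`, `N(0)` convergent.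
Then `T` and `N` converge pointwise, and every constraint, including closedness and area, passes to
the limit (`IsTangentDirector.of_tendsto`).

Lower semicontinuity: `b` is bilinear in a weakly convergent factor (`p`, `q`) and a boundedly,
pointwise convergent one (`T`), and the energy is convex in `b` and `q`
(`reducedEnergy_le_of_tendsto`).

The isoperimetric bound on `A₀` only serves to provide a competitor: an ellipse of the right
proportions, or a figure eight if `A₀ = 0` (`admissible_nonempty`). -/

theorem absolutelyContinuousOnInterval_of_dist_le {X Y : Type*} [PseudoMetricSpace X]
    [PseudoMetricSpace Y] {f : ℝ → X} {G : ℝ → Y} {a b K : ℝ}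
    (hG : AbsolutelyContinuousOnInterval G a b)
    (h : ∀ x ∈ uIcc a b, ∀ y ∈ uIcc a b, dist (f x) (f y) ≤ K * dist (G x) (G y)) :
    AbsolutelyContinuousOnInterval f a b := by
  have hK := Tendsto.const_mul K (show Tendsto _ _ _ from hG)
  rw [mul_zero] at hK
  refine squeeze_zero' ?_ ?_ hK
  · exact Eventually.of_forall fun _ => Finset.sum_nonneg fun _ _ => dist_nonneg
  · filter_upwards [mem_inf_of_right (mem_principal_self _)] with I hI
    rw [Finset.mul_sum]
    refine Finset.sum_le_sum fun i hi => h _ ?_ _ ?_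
    · exact (hI.1 i hi).1
    · exact (hI.1 i hi).2

theorem absolutelyContinuousOnInterval_primitive {g : ℝ → E} {a b : ℝ}
    (hg : IntervalIntegrable g volume a b) :
    AbsolutelyContinuousOnInterval (fun x => ∫ t in a..x, g t) a b := by
  refine absolutelyContinuousOnInterval_of_dist_le (K := 1)
    (hg.norm.absolutelyContinuousOnInterval_intervalIntegral (left_mem_uIcc)) ?_
  intro x hx y hy
  have h1 : IntervalIntegrable g volume a x := hg.mono_set (uIcc_subset_uIcc_left hx)
  have h2 : IntervalIntegrable g volume a y := hg.mono_set (uIcc_subset_uIcc_left hy)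
  rw [dist_eq_norm, dist_eq_norm, intervalIntegral.integral_interval_sub_left h1 h2,
    intervalIntegral.integral_interval_sub_left h1.norm h2.norm, one_mul, Real.norm_eq_abs]
  exact intervalIntegral.norm_integral_le_abs_integral_norm

/-- The fundamental theorem of calculus for vector valued absolutely continuous functions. -/
theorem eq_add_integral_of_absolutelyContinuous {f f' : ℝ → E} [CompleteSpace E] {a b : ℝ}
    (hf : AbsolutelyContinuousOnInterval f a b) (hf' : IntervalIntegrable f' volume a b)
    (h : ∀ᵐ x, x ∈ uIcc a b → HasDerivAt f (f' x) x) {x : ℝ} (hx : x ∈ uIcc a b) :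
    f x = f a + ∫ t in a..x, f' t := by
  -- The difference of `f` and the primitive of `f'` is absolutely continuous with derivative zero
  -- almost everywhere, hence constant.
  obtain ⟨C, hC⟩ := (hf.sub (absolutelyContinuousOnInterval_primitive hf')).const_of_ae_hasDerivAt_zero
    (by
      filter_upwards [h, hf'.ae_hasDerivAt_integral] with x hx₁ hx₂ hx₃
      convert! (hx₁ hx₃).sub (hx₂ hx₃ a (by simp))
      simp)
  have h1 := hC x hx
  have h2 := hC a left_mem_uIcc
  simp only [Pi.sub_apply, intervalIntegral.integral_same, sub_zero] at h1 h2
  rw [h2, ← h1]; abel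

end AbsolutelyContinuous

/-! ### Weak derivatives and primitives on the parameter interval -/

theorem two_pi_pos : (0 : ℝ) < 2 * Real.pi := by positivity

instance isFiniteMeasure_paramMeasure : IsFiniteMeasure paramMeasure := by
  unfold paramMeasure; infer_instance

theorem intervalIntegrable_iff_integrable_param {E : Type*} [NormedAddCommGroup E] {g : ℝ → E} :
    IntervalIntegrable g volume 0 (2 * Real.pi) ↔ Integrable g paramMeasure :=
  intervalIntegrable_iff_integrableOn_Ioo_of_le two_pi_pos.le

theorem intervalIntegrable_of_memLp {E : Type*} [NormedAddCommGroup E] {g : ℝ → E}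
    (hg : MemLp g 2 paramMeasure) : IntervalIntegrable g volume 0 (2 * Real.pi) :=
  intervalIntegrable_iff_integrable_param.2 (hg.integrable (by norm_num))

theorem memLp_of_continuousOn {E : Type*} [NormedAddCommGroup E] [SecondCountableTopology E]
    {u : ℝ → E} (hu : ContinuousOn u paramInterval) : MemLp u 2 paramMeasure := by
  obtain ⟨C, hC⟩ := isCompact_Icc.exists_bound_of_continuousOn hu
  refine MemLp.of_bound ((hu.mono Ioo_subset_Icc_self).aestronglyMeasurable measurableSet_Ioo) C ?_
  exact ae_restrict_of_forall_mem measurableSet_Ioo fun x hx => hC x (Ioo_subset_Icc_self hx)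

theorem integral_param_eq {E : Type*} [NormedAddCommGroup E] [NormedSpace ℝ E] (f : ℝ → E) :
    ∫ x in (0 : ℝ)..(2 * Real.pi), f x = ∫ x, f x ∂paramMeasure := by
  rw [intervalIntegral.integral_of_le two_pi_pos.le, integral_Ioc_eq_integral_Ioo]; rfl

theorem uIcc_param : uIcc 0 (2 * Real.pi) = paramInterval := uIcc_of_le two_pi_pos.le

theorem absolutelyContinuous_of_eq_primitive {u g : ℝ → Plane}
    (hg : IntervalIntegrable g volume 0 (2 * Real.pi))
    (h : ∀ x ∈ paramInterval, u x = u 0 + ∫ t in (0 : ℝ)..x, g t) :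
    AbsolutelyContinuousOnInterval u 0 (2 * Real.pi) := by
  refine absolutelyContinuousOnInterval_of_dist_le (K := 1)
    (absolutelyContinuousOnInterval_primitive hg) fun x hx y hy => ?_
  rw [uIcc_param] at hx hy
  rw [h x hx, h y hy, dist_add_left, one_mul]

theorem continuousOn_of_eq_primitive {u g : ℝ → Plane}
    (hg : IntervalIntegrable g volume 0 (2 * Real.pi))
    (h : ∀ x ∈ paramInterval, u x = u 0 + ∫ t in (0 : ℝ)..x, g t) :
    ContinuousOn u paramInterval :=
  uIcc_param ▸ (absolutelyContinuous_of_eq_primitive hg h).continuousOn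

theorem ae_hasDerivAt_of_eq_primitive {u g : ℝ → Plane}
    (hg : IntervalIntegrable g volume 0 (2 * Real.pi))
    (h : ∀ x ∈ paramInterval, u x = u 0 + ∫ t in (0 : ℝ)..x, g t) :
    ∀ᵐ x, x ∈ uIcc 0 (2 * Real.pi) → HasDerivAt u (g x) x := by
  have e0 : ∀ᵐ x : ℝ, x ≠ 0 := by simp [ae_iff, measure_singleton]
  have e1 : ∀ᵐ x : ℝ, x ≠ 2 * Real.pi := by simp [ae_iff, measure_singleton]
  filter_upwards [hg.ae_hasDerivAt_integral, e0, e1] with x hx hx0 hx1 hxI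
  have hd := (hx hxI 0 left_mem_uIcc).const_add (u 0)
  rw [uIcc_param] at hxI
  have hxm : paramInterval ∈ 𝓝 x :=
    Icc_mem_nhds (lt_of_le_of_ne hxI.1 hx0.symm) (lt_of_le_of_ne hxI.2 hx1)
  exact hd.congr_of_eventuallyEq (by filter_upwards [hxm] with y hy using h y hy)

/-- The product of `u` with a test function is absolutely continuous and vanishes at both end
points, so the integral of its derivative is zero. -/
theorem isWeakDeriv_of_eq_primitive {u g : ℝ → Plane}
    (hg : IntervalIntegrable g volume 0 (2 * Real.pi))
    (h : ∀ x ∈ paramInterval, u x = u 0 + ∫ t in (0 : ℝ)..x, g t) : IsWeakDeriv u g := by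
  intro φ hφ _ hsupp
  have hu : ContinuousOn u paramInterval := continuousOn_of_eq_primitive hg h
  have h0 : φ 0 = 0 := by
    by_contra h0
    exact lt_irrefl _ (hsupp (subset_tsupport _ h0)).1
  have h1 : φ (2 * Real.pi) = 0 := by
    by_contra h0
    exact lt_irrefl _ (hsupp (subset_tsupport _ h0)).2
  have hφd : Differentiable ℝ φ := hφ.differentiable (by simp)
  have hφ' : Continuous (deriv φ) := hφ.continuous_deriv (by simp)
  have hφAC : AbsolutelyContinuousOnInterval φ 0 (2 * Real.pi) :=
    (hφ.contDiffOn.of_le (by simp)).absolutelyContinuousOnInterval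
  have hi1 : IntervalIntegrable (fun x => deriv φ x • u x) volume 0 (2 * Real.pi) :=
    (hφ'.continuousOn.smul (uIcc_param ▸ hu)).intervalIntegrable
  have hi2 : IntervalIntegrable (fun x => φ x • g x) volume 0 (2 * Real.pi) :=
    hg.continuousOn_smul hφ.continuous.continuousOn
  have := eq_add_integral_of_absolutelyContinuous
    (hφAC.smul (absolutelyContinuous_of_eq_primitive hg h)) (hi1.add hi2) ?_ right_mem_uIcc
  · simp only [Pi.smul_apply', h0, h1, zero_smul, zero_add] at this
    rw [intervalIntegral.integral_add hi1 hi2] at this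
    exact eq_neg_of_add_eq_zero_left this.symm
  · filter_upwards [ae_hasDerivAt_of_eq_primitive hg h] with x hx hxI
    have := (hφd x).hasDerivAt.smul (hx hxI)
    rwa [add_comm] at this

/-- The primitive of a test function of zero mean is a test function. -/
theorem exists_test_primitive {χ : ℝ → ℝ} (h1 : ContDiff ℝ ∞ χ) (h2 : HasCompactSupport χ)
    (h3 : tsupport χ ⊆ Ioo 0 (2 * Real.pi)) (h4 : ∫ x in (0 : ℝ)..(2 * Real.pi), χ x = 0) :
    ∃ φ : ℝ → ℝ, ContDiff ℝ ∞ φ ∧ HasCompactSupport φ ∧ tsupport φ ⊆ Ioo 0 (2 * Real.pi) ∧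
      deriv φ = χ := by
  have hd : ∀ x, HasDerivAt (fun x => ∫ t in (0 : ℝ)..x, χ t) (χ x) x := fun x =>
    h1.continuous.integral_hasStrictDerivAt 0 x |>.hasDerivAt
  have hder : deriv (fun x => ∫ t in (0 : ℝ)..x, χ t) = χ := funext fun x => (hd x).deriv
  obtain ⟨a, b, ha, hb, hab⟩ : ∃ a b, 0 < a ∧ b < 2 * Real.pi ∧ tsupport χ ⊆ Icc a b := by
    by_cases hne : (tsupport χ).Nonempty
    · obtain ⟨a, ha⟩ := h2.isCompact.exists_isLeast hne
      obtain ⟨b, hb⟩ := h2.isCompact.exists_isGreatest hne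
      exact ⟨a, b, (h3 ha.1).1, (h3 hb.1).2, fun x hx => ⟨ha.2 hx, hb.2 hx⟩⟩
    · rw [not_nonempty_iff_eq_empty] at hne
      exact ⟨1, 1, one_pos, by linarith [Real.pi_gt_three], by simp [hne]⟩
  have hz : ∀ x, x ∉ Icc a b → χ x = 0 := fun x hx => by
    by_contra h
    exact hx (hab (subset_tsupport _ h))
  have hint : ∀ x y, IntervalIntegrable χ volume x y := fun x y =>
    h1.continuous.intervalIntegrable x y
  have hs : Function.support (fun x => ∫ t in (0 : ℝ)..x, χ t) ⊆ Icc a b := by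
    intro x hx
    by_contra hxI
    apply hx
    beta_reduce
    rcases lt_or_ge x a with h | h
    · rw [intervalIntegral.integral_congr (g := fun _ => 0), intervalIntegral.integral_zero]
      intro t ht
      refine hz t fun hmem => ?_
      have : t ≤ max 0 x := ht.2
      exact absurd (hmem.1.trans this) (not_le.mpr (max_lt ha h))
    · have hbx : b < x := by
        by_contra hb'
        exact hxI ⟨h, not_lt.mp hb'⟩
      -- To the right of the support the primitive equals the full integral of `χ`; this is where
      -- the zero mean is needed.
      have : ∫ t in x..(2 * Real.pi), χ t = 0 := by
        rw [intervalIntegral.integral_congr (g := fun _ => 0), intervalIntegral.integral_zero]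
        intro t ht
        refine hz t fun hmem => ?_
        have : min x (2 * Real.pi) ≤ t := ht.1
        exact absurd (this.trans hmem.2) (not_le.mpr (lt_min hbx hb))
      rw [← intervalIntegral.integral_add_adjacent_intervals (hint 0 x) (hint x _), this,
        add_zero] at h4
      exact h4
  have hts : tsupport (fun x => ∫ t in (0 : ℝ)..x, χ t) ⊆ Icc a b :=
    closure_minimal hs isClosed_Icc
  refine ⟨_, ?_, ?_, hts.trans fun x hx => ⟨ha.trans_le hx.1, hx.2.trans_lt hb⟩, hder⟩
  · rw [contDiff_infty_iff_deriv, hder]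
    exact ⟨fun x => (hd x).differentiableAt, h1⟩
  · exact HasCompactSupport.of_support_subset_isCompact isCompact_Icc hs

theorem integral_univ_eq_of_tsupport {φ : ℝ → ℝ} (h : tsupport φ ⊆ Ioo 0 (2 * Real.pi))
    (f : ℝ → Plane) : ∫ x, φ x • f x = ∫ x in (0 : ℝ)..(2 * Real.pi), φ x • f x := by
  rw [intervalIntegral.integral_of_le two_pi_pos.le, setIntegral_eq_integral_of_forall_compl_eq_zero]
  intro x hx
  have : φ x = 0 := by
    by_contra h0
    exact hx (Ioo_subset_Ioc_self (h (subset_tsupport _ h0)))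
  rw [this, zero_smul]

theorem ae_eq_zero_of_integral_test {f : ℝ → Plane}
    (hf : IntervalIntegrable f volume 0 (2 * Real.pi))
    (h : ∀ φ : ℝ → ℝ, ContDiff ℝ ∞ φ → HasCompactSupport φ → tsupport φ ⊆ Ioo 0 (2 * Real.pi) →
      ∫ x in (0 : ℝ)..(2 * Real.pi), φ x • f x = 0) :
    f =ᵐ[paramMeasure] 0 := by
  rw [intervalIntegrable_iff_integrableOn_Ioo_of_le two_pi_pos.le] at hf
  have := isOpen_Ioo.ae_eq_zero_of_integral_contDiff_smul_eq_zero hf.locallyIntegrableOn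
    fun g h1 h2 h3 => (integral_univ_eq_of_tsupport h3 f).trans (h g h1 h2 h3)
  exact (ae_restrict_iff' measurableSet_Ioo).2 this

theorem IsWeakDeriv.ae_unique {u g g' : ℝ → Plane} (h : IsWeakDeriv u g) (h' : IsWeakDeriv u g')
    (hg : IntervalIntegrable g volume 0 (2 * Real.pi))
    (hg' : IntervalIntegrable g' volume 0 (2 * Real.pi)) : g =ᵐ[paramMeasure] g' := by
  have := ae_eq_zero_of_integral_test (hg.sub hg') fun φ h1 h2 h3 => by
    have e := (h φ h1 h2 h3).symm.trans (h' φ h1 h2 h3)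
    simp only [smul_sub]
    rw [intervalIntegral.integral_sub (hg.continuousOn_smul h1.continuous.continuousOn)
      (hg'.continuousOn_smul h1.continuous.continuousOn), neg_inj.mp e, sub_self]
  filter_upwards [this] with x hx using sub_eq_zero.mp hx

/-- The lemma of du Bois-Reymond. -/
theorem exists_const_of_integral_deriv_test {w : ℝ → Plane} (hw : ContinuousOn w paramInterval)
    (h : ∀ φ : ℝ → ℝ, ContDiff ℝ ∞ φ → HasCompactSupport φ → tsupport φ ⊆ Ioo 0 (2 * Real.pi) →
      ∫ x in (0 : ℝ)..(2 * Real.pi), deriv φ x • w x = 0) :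
    ∃ C, ∀ x ∈ paramInterval, w x = C := by
  have hpi := Real.pi_gt_three
  -- Outer radius 2 keeps the support inside `(0, 2π)`, because `π > 3`.
  let B : ContDiffBump (Real.pi : ℝ) := ⟨1, 2, one_pos, by norm_num⟩
  let ρ : ℝ → ℝ := B.normed volume
  have hρ1 : ContDiff ℝ ∞ ρ := B.contDiff_normed
  have hρ2 : HasCompactSupport ρ := B.hasCompactSupport_normed
  have hρ3 : tsupport ρ ⊆ Ioo 0 (2 * Real.pi) := by
    rw [B.tsupport_normed_eq, Real.closedBall_eq_Icc]
    intro x hx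
    have h1 : Real.pi - 2 ≤ x := hx.1
    have h2 : x ≤ Real.pi + 2 := hx.2
    exact ⟨by linarith, by linarith⟩
  have hρ4 : ∫ x in (0 : ℝ)..(2 * Real.pi), ρ x = 1 := by
    rw [intervalIntegral.integral_of_le two_pi_pos.le,
      setIntegral_eq_integral_of_forall_compl_eq_zero]
    · exact B.integral_normed
    · intro x hx
      by_contra h0
      exact hx (Ioo_subset_Ioc_self (hρ3 (subset_tsupport _ h0)))
  have hw' : ContinuousOn w (uIcc 0 (2 * Real.pi)) := uIcc_param ▸ hw
  have hint : ∀ ψ : ℝ → ℝ, Continuous ψ →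
      IntervalIntegrable (fun x => ψ x • w x) volume 0 (2 * Real.pi) := fun ψ hψ =>
    (hψ.continuousOn.smul hw').intervalIntegrable
  set C := ∫ x in (0 : ℝ)..(2 * Real.pi), ρ x • w x with hC
  have hwi : IntervalIntegrable (fun x => w x - C) volume 0 (2 * Real.pi) :=
    (hw'.sub continuousOn_const).intervalIntegrable
  -- For any test function `ψ` of integral `m`, `ψ - mρ` has zero mean and so is the derivative of a
  -- test function. The hypothesis then gives `∫ ψ w = m ∫ ρ w = ∫ ψ C`.
  have hae := ae_eq_zero_of_integral_test hwi fun ψ h1 h2 h3 => by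
    set m := ∫ x in (0 : ℝ)..(2 * Real.pi), ψ x with hm
    have hts : tsupport (fun x => ψ x - m * ρ x) ⊆ tsupport ψ ∪ tsupport ρ := by
      refine closure_minimal ?_ ((isClosed_tsupport _).union (isClosed_tsupport _))
      intro x hx
      by_contra hn
      rw [mem_union, not_or] at hn
      exact hx (by simp [image_eq_zero_of_notMem_tsupport hn.1,
        image_eq_zero_of_notMem_tsupport hn.2])
    obtain ⟨φ, a1, a2, a3, a4⟩ := exists_test_primitive (χ := fun x => ψ x - m * ρ x)
      (h1.sub (contDiff_const.mul hρ1))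
      (HasCompactSupport.of_support_subset_isCompact (h2.isCompact.union hρ2.isCompact)
        ((subset_tsupport _).trans hts)) (hts.trans (union_subset h3 hρ3)) (by
        rw [intervalIntegral.integral_sub (h1.continuous.intervalIntegrable _ _)
          ((hρ1.continuous.intervalIntegrable _ _).const_mul m),
          intervalIntegral.integral_const_mul, hρ4, mul_one, sub_self])
    have e := h φ a1 a2 a3
    rw [a4] at e
    simp only [sub_smul, mul_smul] at e
    have hm' : IntervalIntegrable (fun x => m • ρ x • w x) volume 0 (2 * Real.pi) :=
      (hint ρ hρ1.continuous).smul m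
    rw [intervalIntegral.integral_sub (hint ψ h1.continuous) hm', intervalIntegral.integral_smul, ← hC] at e
    simp only [smul_sub]
    have hc' : IntervalIntegrable (fun x => ψ x • C) volume 0 (2 * Real.pi) :=
      (h1.continuous.smul continuous_const).intervalIntegrable _ _
    rw [intervalIntegral.integral_sub (hint ψ h1.continuous) hc',
      intervalIntegral.integral_smul_const, ← hm]
    exact e
  refine ⟨C, fun x hx => sub_eq_zero.mp ?_⟩
  have := Measure.eqOn_Icc_of_ae_eq (μ := volume) (f := fun x => w x - C) (g := 0)
    two_pi_pos.ne (by
      rw [Measure.restrict_congr_set Ioo_ae_eq_Icc.symm]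
      exact hae) (hw.sub continuousOn_const) continuousOn_const
  exact this hx

/-- The primitive of `g` has the same weak derivative as `u`, so by du Bois-Reymond the two differ
by a constant. -/
theorem IsWeakDeriv.eq_primitive {u g : ℝ → Plane} (hu : ContinuousOn u paramInterval)
    (hg : IntervalIntegrable g volume 0 (2 * Real.pi)) (h : IsWeakDeriv u g) :
    ∀ x ∈ paramInterval, u x = u 0 + ∫ t in (0 : ℝ)..x, g t := by
  have hG := isWeakDeriv_of_eq_primitive (u := fun x => ∫ t in (0 : ℝ)..x, g t) hg (by simp)
  have hGc : ContinuousOn (fun x => ∫ t in (0 : ℝ)..x, g t) paramInterval :=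
    continuousOn_of_eq_primitive hg (by simp)
  obtain ⟨C, hC⟩ := exists_const_of_integral_deriv_test (hu.sub hGc) fun φ h1 h2 h3 => by
    have hφ' : Continuous (deriv φ) := h1.continuous_deriv (by simp)
    have i1 : IntervalIntegrable (fun x => deriv φ x • u x) volume 0 (2 * Real.pi) :=
      (hφ'.continuousOn.smul (uIcc_param ▸ hu)).intervalIntegrable
    have i2 : IntervalIntegrable (fun x => deriv φ x • ∫ t in (0 : ℝ)..x, g t) volume 0
        (2 * Real.pi) := (hφ'.continuousOn.smul (uIcc_param ▸ hGc)).intervalIntegrable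
    simp only [Pi.sub_apply, smul_sub]
    rw [intervalIntegral.integral_sub i1 i2, h φ h1 h2 h3, hG φ h1 h2 h3,
      sub_self]
  intro x hx
  have e0 := hC 0 ⟨le_rfl, two_pi_pos.le⟩
  have e1 := hC x hx
  simp only [Pi.sub_apply, intervalIntegral.integral_same, sub_zero] at e0 e1
  rw [e0, ← e1]; abel

theorem IsWeakDeriv.congr_ae {u u' g : ℝ → Plane} (h : IsWeakDeriv u g)
    (hu : u =ᵐ[paramMeasure] u') : IsWeakDeriv u' g := by
  intro φ h1 h2 h3
  rw [← h φ h1 h2 h3, integral_param_eq, integral_param_eq]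
  refine integral_congr_ae ?_
  filter_upwards [hu] with x hx
  rw [hx]

theorem weakDeriv_spec {u g : ℝ → Plane} (hg : MemLp g 2 paramMeasure) (h : IsWeakDeriv u g) :
    MemLp (weakDeriv u) 2 paramMeasure ∧ IsWeakDeriv u (weakDeriv u) := by
  have hex : ∃ g, MemLp g 2 paramMeasure ∧ IsWeakDeriv u g := ⟨g, hg, h⟩
  rw [weakDeriv, dif_pos hex]
  exact hex.choose_spec

theorem weakDeriv_ae_eq {u g : ℝ → Plane} (hg : MemLp g 2 paramMeasure) (h : IsWeakDeriv u g) :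
    weakDeriv u =ᵐ[paramMeasure] g := by
  obtain ⟨h1, h2⟩ := weakDeriv_spec hg h
  exact h2.ae_unique h (intervalIntegrable_of_memLp h1) (intervalIntegrable_of_memLp hg)

/-! ### Rotation and plane geometry -/

section Rotation

/-- The rotation `rot` as a continuous linear map. -/
def rotL : Plane →L[ℝ] Plane :=
  LinearMap.toContinuousLinearMap
    { toFun := rot
      map_add' := fun v w => by
        ext i; fin_cases i <;> simp [rot, add_comm]
      map_smul' := fun a v => by
        ext i; fin_cases i <;> simp [rot] }

theorem rot_smul (a : ℝ) (v : Plane) : rot (a • v) = a • rot v := rotL.map_smul a v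

theorem continuous_rot : Continuous rot := rotL.continuous

theorem plane_inner (v w : Plane) : inner ℝ v w = v 0 * w 0 + v 1 * w 1 := by
  simp [PiLp.inner_apply, Fin.sum_univ_two, mul_comm]

theorem plane_norm_sq (v : Plane) : ‖v‖ ^ 2 = v 0 ^ 2 + v 1 ^ 2 := by
  rw [EuclideanSpace.norm_sq_eq, Fin.sum_univ_two]; simp

theorem norm_rot (v : Plane) : ‖rot v‖ = ‖v‖ := by
  rw [← sq_eq_sq₀ (norm_nonneg _) (norm_nonneg _), plane_norm_sq, plane_norm_sq]
  simp [rot, add_comm]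

/-- Pythagoras in the orthogonal frame `w`, `Jw`. For `w` a unit vector normal to `v` it says that
`|v| = |⟨v, Jw⟩|`, which turns a curvature bound into a bound on the derivative of the tangent. -/
theorem norm_sq_mul_norm_sq (v w : Plane) :
    ‖v‖ ^ 2 * ‖w‖ ^ 2 = inner ℝ v w ^ 2 + inner ℝ v (rot w) ^ 2 := by
  rw [plane_inner, plane_inner, plane_norm_sq, plane_norm_sq]
  simp only [rot, PiLp.toLp_apply, Matrix.cons_val_zero, Matrix.cons_val_one]
  ring

theorem normSq_gradient (γ η : ℝ → Plane) (x : ℝ) :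
    normSq (gradient γ η x) = ‖arcDeriv γ η x‖ ^ 2 * ‖tangent γ x‖ ^ 2 := by
  rw [plane_norm_sq, plane_norm_sq]
  simp only [normSq, gradient, Fin.sum_univ_two, Matrix.of_apply]
  ring

end Rotation

/-! ### Normalizing a nowhere vanishing field -/

section Normalization

theorem norm_normalize_sub_le {E : Type*} [NormedAddCommGroup E] [NormedSpace ℝ E] {v w : E}
    {m : ℝ} (hm : 0 < m) (hv : m ≤ ‖v‖) (hw : m ≤ ‖w‖) :
    ‖‖v‖⁻¹ • v - ‖w‖⁻¹ • w‖ ≤ 2 / m * ‖v - w‖ := by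
  have hv0 : 0 < ‖v‖ := hm.trans_le hv
  have hw0 : 0 < ‖w‖ := hm.trans_le hw
  have e : ‖v‖⁻¹ • v - ‖w‖⁻¹ • w = ‖v‖⁻¹ • (v - w) + (‖v‖⁻¹ - ‖w‖⁻¹) • w := by
    rw [smul_sub, sub_smul]; abel
  have h1 : ‖‖v‖⁻¹ • (v - w)‖ ≤ m⁻¹ * ‖v - w‖ := by
    rw [norm_smul, norm_inv, norm_norm]
    gcongr
  have h2 : ‖(‖v‖⁻¹ - ‖w‖⁻¹) • w‖ ≤ m⁻¹ * ‖v - w‖ := by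
    have : ‖(‖v‖⁻¹ - ‖w‖⁻¹) • w‖ = ‖v‖⁻¹ * |‖w‖ - ‖v‖| := by
      rw [norm_smul, inv_sub_inv hv0.ne' hw0.ne', Real.norm_eq_abs, abs_div,
        abs_of_pos (mul_pos hv0 hw0)]
      field_simp
    rw [this]
    have : |‖w‖ - ‖v‖| ≤ ‖v - w‖ := by
      rw [norm_sub_rev]; exact abs_norm_sub_norm_le w v
    gcongr
  rw [e]
  refine (norm_add_le _ _).trans ((add_le_add h1 h2).trans_eq ?_)
  ring

/-- By compactness `|v|` is bounded below, so `w ↦ w/|w|` is Lipschitz on the values of `v` and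
preserves absolute continuity. The chain rule gives the derivative almost everywhere, and it is
square integrable because the differential of the normalization is bounded along `v`. -/
theorem exists_memLp_primitive_normalize {v g : ℝ → Plane} (hg : MemLp g 2 paramMeasure)
    (h : ∀ x ∈ paramInterval, v x = v 0 + ∫ t in (0 : ℝ)..x, g t)
    (hv : ∀ x ∈ paramInterval, v x ≠ 0) :
    ∃ p, MemLp p 2 paramMeasure ∧ ∀ x ∈ paramInterval,
      ‖v x‖⁻¹ • v x = ‖v 0‖⁻¹ • v 0 + ∫ t in (0 : ℝ)..x, p t := by
  have hgi := intervalIntegrable_of_memLp hg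
  have hvc : ContinuousOn v paramInterval := continuousOn_of_eq_primitive hgi h
  obtain ⟨x₀, hx₀, hmin⟩ := isCompact_Icc.exists_isMinOn
    (nonempty_Icc.2 two_pi_pos.le) hvc.norm
  set m := ‖v x₀‖ with hm
  have hm0 : 0 < m := norm_pos_iff.2 (hv x₀ hx₀)
  have hmv : ∀ x ∈ paramInterval, m ≤ ‖v x‖ := fun x hx => hmin hx
  let Φ : Plane → Plane := fun w => ‖w‖⁻¹ • w
  have hΦ : ContDiffOn ℝ 1 Φ {0}ᶜ := fun w hw =>
    ((contDiffAt_norm ℝ hw).inv (norm_ne_zero_iff.2 hw)).smul contDiffAt_id |>.contDiffWithinAt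
  have hDc : ContinuousOn (fun x => fderiv ℝ Φ (v x)) paramInterval :=
    (hΦ.continuousOn_fderiv_of_isOpen isOpen_compl_singleton le_rfl).comp hvc hv
  obtain ⟨C, hC⟩ := isCompact_Icc.exists_bound_of_continuousOn hDc
  have hp : MemLp (fun x => fderiv ℝ Φ (v x) (g x)) 2 paramMeasure := by
    refine hg.of_le_mul (c := C) ?_ ?_
    · exact (ContinuousLinearMap.id ℝ (Plane →L[ℝ] Plane)).aestronglyMeasurable_comp₂
        ((hDc.mono Ioo_subset_Icc_self).aestronglyMeasurable measurableSet_Ioo) hg.1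
    · refine ae_restrict_of_forall_mem measurableSet_Ioo fun x hx => ?_
      exact (ContinuousLinearMap.le_opNorm _ _).trans
        (mul_le_mul_of_nonneg_right (hC x (Ioo_subset_Icc_self hx)) (norm_nonneg _))
  refine ⟨_, hp, fun x hx => ?_⟩
  have hAC : AbsolutelyContinuousOnInterval (fun x => Φ (v x)) 0 (2 * Real.pi) := by
    refine absolutelyContinuousOnInterval_of_dist_le (K := 2 / m)
      (absolutelyContinuous_of_eq_primitive hgi h) fun x hx y hy => ?_
    rw [uIcc_param] at hx hy
    rw [dist_eq_norm, dist_eq_norm]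
    exact norm_normalize_sub_le hm0 (hmv x hx) (hmv y hy)
  refine eq_add_integral_of_absolutelyContinuous hAC (intervalIntegrable_of_memLp hp) ?_
    (uIcc_param ▸ hx)
  filter_upwards [ae_hasDerivAt_of_eq_primitive hgi h] with x hx hxI
  have hd : DifferentiableAt ℝ Φ (v x) :=
    (hΦ.contDiffAt (isOpen_compl_singleton.mem_nhds (hv x (uIcc_param ▸ hxI)))).differentiableAt
      one_ne_zero
  exact hd.hasFDerivAt.comp_hasDerivAt x (hx hxI)

end Normalization

/-! ### Change of variables by arc length -/

section Reparametrization

/-- The rescaled arc length function of a curve with speed `w`. -/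
def arcParam (w : ℝ → ℝ) (c x : ℝ) : ℝ := c⁻¹ * ∫ t in (0 : ℝ)..x, w t

/-- The inverse of the rescaled arc length function. -/
def arcInv (w : ℝ → ℝ) (c : ℝ) : ℝ → ℝ := Function.invFun (arcParam w c)

variable {w : ℝ → ℝ} {c : ℝ}

theorem hasDerivAt_arcParam (hw : Continuous w) (x : ℝ) :
    HasDerivAt (arcParam w c) (c⁻¹ * w x) x :=
  ((hw.integral_hasStrictDerivAt 0 x).hasDerivAt).const_mul _

theorem strictMono_arcParam (hw : Continuous w) (hpos : ∀ x, 0 < w x) (hc : 0 < c) :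
    StrictMono (arcParam w c) :=
  strictMono_of_hasDerivAt_pos (fun x => hasDerivAt_arcParam hw x)
    fun x => mul_pos (inv_pos.2 hc) (hpos x)

theorem arcParam_zero : arcParam w c 0 = 0 := by simp [arcParam]

theorem arcInv_arcParam (hw : Continuous w) (hpos : ∀ x, 0 < w x) (hc : 0 < c) (x : ℝ) :
    arcInv w c (arcParam w c x) = x :=
  Function.leftInverse_invFun (strictMono_arcParam hw hpos hc).injective x

theorem image_arcParam (hw : Continuous w) (hpos : ∀ x, 0 < w x) (hc : 0 < c) {x : ℝ}
    (hx : 0 ≤ x) : arcParam w c '' Icc 0 x = Icc 0 (arcParam w c x) := by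
  have hm := (strictMono_arcParam hw hpos hc).monotone
  have hcont : Continuous (arcParam w c) :=
    continuous_iff_continuousAt.2 fun x => (hasDerivAt_arcParam hw x).continuousAt
  apply Subset.antisymm
  · rintro _ ⟨y, hy, rfl⟩
    exact ⟨arcParam_zero (w := w) (c := c) ▸ hm hy.1, hm hy.2⟩
  · have := intermediate_value_Icc hx hcont.continuousOn
    rwa [arcParam_zero] at this

variable {E : Type*} [NormedAddCommGroup E] [NormedSpace ℝ E]

/-- Substitution along the increasing map `arcParam` itself. Only `arcInv (arcParam x) = x` is used,
so neither differentiability of the inverse nor regularity of `F` is needed. -/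
theorem integral_comp_arcInv (hw : Continuous w) (hpos : ∀ x, 0 < w x) (hc : 0 < c) (F : ℝ → E)
    {x : ℝ} (hx : 0 ≤ x) :
    ∫ y in (0 : ℝ)..arcParam w c x, F (arcInv w c y) =
      ∫ t in (0 : ℝ)..x, (c⁻¹ * w t) • F t := by
  have hm := (strictMono_arcParam hw hpos hc).monotone
  have h0 : 0 ≤ arcParam w c x := arcParam_zero (w := w) (c := c) ▸ hm hx
  rw [intervalIntegral.integral_of_le h0, intervalIntegral.integral_of_le hx,
    ← integral_Icc_eq_integral_Ioc, ← integral_Icc_eq_integral_Ioc,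
    ← image_arcParam hw hpos hc hx,
    integral_image_eq_integral_deriv_smul_of_monotoneOn measurableSet_Icc
      (fun x _ => (hasDerivAt_arcParam hw x).hasDerivWithinAt) (hm.monotoneOn _)]
  simp only [arcInv_arcParam hw hpos hc]

theorem integrable_comp_arcInv (hw : Continuous w) (hpos : ∀ x, 0 < w x) (hc : 0 < c)
    (h2π : arcParam w c (2 * Real.pi) = 2 * Real.pi) {F : ℝ → E}
    (hF : Integrable F paramMeasure) :
    Integrable (fun y => F (arcInv w c y)) paramMeasure := by
  have hm := (strictMono_arcParam hw hpos hc).monotone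
  rw [← intervalIntegrable_iff_integrable_param] at hF ⊢
  have h1 : IntervalIntegrable (fun t => (c⁻¹ * w t) • F t) volume 0 (2 * Real.pi) :=
    hF.continuousOn_smul (continuous_const.mul hw).continuousOn
  rw [intervalIntegrable_iff_integrableOn_Icc_of_le two_pi_pos.le] at h1 ⊢
  have := image_arcParam hw hpos hc two_pi_pos.le
  rw [h2π] at this
  rw [← this, integrableOn_image_iff_integrableOn_deriv_smul_of_monotoneOn measurableSet_Icc
      (fun x _ => (hasDerivAt_arcParam hw x).hasDerivWithinAt) (hm.monotoneOn _)]
  simpa only [arcInv_arcParam hw hpos hc] using h1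

theorem memLp_comp_arcInv (hw : Continuous w) (hpos : ∀ x, 0 < w x) (hc : 0 < c)
    (h2π : arcParam w c (2 * Real.pi) = 2 * Real.pi) {F : ℝ → E}
    (hF : MemLp F 2 paramMeasure) : MemLp (fun y => F (arcInv w c y)) 2 paramMeasure := by
  have h1 := integrable_comp_arcInv hw hpos hc h2π (hF.integrable (by norm_num))
  rw [memLp_two_iff_integrable_sq_norm h1.aestronglyMeasurable]
  exact integrable_comp_arcInv hw hpos hc h2π
    ((memLp_two_iff_integrable_sq_norm hF.1).1 hF)

end Reparametrization

/-! ### From curves to tangent fields and back -/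

theorem memLp_smul_of_continuousOn {E : Type*} [NormedAddCommGroup E] [NormedSpace ℝ E]
    {a : ℝ → ℝ} {p : ℝ → E} (ha : ContinuousOn a paramInterval)
    (hp : MemLp p 2 paramMeasure) : MemLp (fun x => a x • p x) 2 paramMeasure := by
  obtain ⟨C, hC⟩ := isCompact_Icc.exists_bound_of_continuousOn ha
  refine hp.of_le_mul (c := C) (((ha.mono Ioo_subset_Icc_self).aestronglyMeasurable
    measurableSet_Ioo).smul hp.1) ?_
  refine ae_restrict_of_forall_mem measurableSet_Ioo fun x hx => ?_
  rw [norm_smul]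
  exact mul_le_mul_of_nonneg_right (hC x (Ioo_subset_Icc_self hx)) (norm_nonneg _)

theorem zero_mem_param : (0 : ℝ) ∈ paramInterval := ⟨le_rfl, two_pi_pos.le⟩

theorem two_pi_mem_param : 2 * Real.pi ∈ paramInterval := ⟨two_pi_pos.le, le_rfl⟩

theorem uIcc_zero_subset_param {x : ℝ} (hx : x ∈ paramInterval) :
    uIcc 0 x ⊆ paramInterval := by
  rw [uIcc_of_le hx.1]; exact Icc_subset_Icc_right hx.2

/-- A tangent field `T` and a director field `N` along a closed curve of constant speed `c` and
area `A`, together with their derivatives `p` and `q`. -/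
structure IsTangentDirector (c A : ℝ) (T N p q : ℝ → Plane) : Prop where
  memLp_p : MemLp p 2 paramMeasure
  memLp_q : MemLp q 2 paramMeasure
  T_eq : ∀ x ∈ paramInterval, T x = T 0 + ∫ t in (0 : ℝ)..x, p t
  N_eq : ∀ x ∈ paramInterval, N x = N 0 + ∫ t in (0 : ℝ)..x, q t
  norm_T : ∀ x ∈ paramInterval, ‖T x‖ = 1
  norm_N : ∀ x ∈ paramInterval, ‖N x‖ = 1
  T_per : T 0 = T (2 * Real.pi)
  N_per : N 0 = N (2 * Real.pi)
  closed : ∫ t in (0 : ℝ)..(2 * Real.pi), T t = 0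
  area_eq : -(1 / 2) * c ^ 2 * ∫ x in (0 : ℝ)..(2 * Real.pi),
    inner ℝ (∫ t in (0 : ℝ)..x, T t) (rot (T x)) = A

/-- The energy density, up to the factor `c⁻¹`, in terms of tangent and director. -/
def bendingDensity (δ : ℝ) (T p q : ℝ → Plane) (x : ℝ) : ℝ :=
  inner ℝ (p x) (rot (T x)) + δ * inner ℝ (q x) (T x)

/-- The energy in terms of tangent and director. -/
def reducedEnergy (δ lam c : ℝ) (T p q : ℝ → Plane) : ℝ :=
  1 / (2 * c) * (∫ x in (0 : ℝ)..(2 * Real.pi), bendingDensity δ T p q x ^ 2) +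
    lam / (2 * c) * ∫ x in (0 : ℝ)..(2 * Real.pi), ‖q x‖ ^ 2

theorem continuousOn_dx {γ : ℝ → Plane} (h : ContDiffOn ℝ 1 γ paramInterval) :
    ContinuousOn (dx γ) paramInterval :=
  h.continuousOn_derivWithin (uniqueDiffOn_Icc two_pi_pos) le_rfl

theorem eq_primitive_dx {γ : ℝ → Plane} (h : ContDiffOn ℝ 1 γ paramInterval) :
    ∀ x ∈ paramInterval, γ x = γ 0 + ∫ t in (0 : ℝ)..x, dx γ t := by
  intro x hx
  have hsub : Icc 0 x ⊆ paramInterval := Icc_subset_Icc_right hx.2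
  rw [intervalIntegral.integral_eq_sub_of_hasDerivAt_of_le hx.1 (h.continuousOn.mono hsub)
    (fun y hy => ?_) ((continuousOn_dx h).mono (uIcc_zero_subset_param hx)).intervalIntegrable]
  · abel
  · have hm : paramInterval ∈ 𝓝 y := Icc_mem_nhds hy.1 (hy.2.trans_le hx.2)
    exact ((h.differentiableOn one_ne_zero y (hsub ⟨hy.1.le, hy.2.le⟩)).hasDerivWithinAt).hasDerivAt hm

/-- The weak derivative supplied by `MemH 2 γ` agrees almost everywhere with the continuous `dx γ`,
which therefore inherits the second weak derivative and is its primitive. Normalization then yields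
the tangent. -/
theorem tangent_spec {γ : ℝ → Plane} (h : γ ∈ HImm2) :
    MemLp (weakDeriv (tangent γ)) 2 paramMeasure ∧ ∀ x ∈ paramInterval,
      tangent γ x = tangent γ 0 + ∫ t in (0 : ℝ)..x, weakDeriv (tangent γ) t := by
  obtain ⟨hC, ⟨-, g₁, hg₁, hg₁L, g₂, hg₂, hg₂L⟩, hne, -, -⟩ := h
  have hv := continuousOn_dx hC
  have hvi : IntervalIntegrable (dx γ) volume 0 (2 * Real.pi) :=
    (uIcc_param ▸ hv : ContinuousOn (dx γ) (uIcc 0 (2 * Real.pi))).intervalIntegrable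
  have hae := hg₁.ae_unique (isWeakDeriv_of_eq_primitive hvi (eq_primitive_dx hC))
    (intervalIntegrable_of_memLp hg₁L) hvi
  have hveq := (hg₂.congr_ae hae).eq_primitive hv (intervalIntegrable_of_memLp hg₂L)
  obtain ⟨p, hp, hτ⟩ := exists_memLp_primitive_normalize hg₂L hveq hne
  have hpi := intervalIntegrable_of_memLp hp
  obtain ⟨h1, h2⟩ := weakDeriv_spec hp (isWeakDeriv_of_eq_primitive (u := tangent γ) hpi hτ)
  exact ⟨h1, h2.eq_primitive (continuousOn_of_eq_primitive hpi hτ)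
    (intervalIntegrable_of_memLp h1)⟩

theorem director_spec {η : ℝ → Plane} (h : η ∈ HPer1) :
    MemLp (weakDeriv η) 2 paramMeasure ∧ ∀ x ∈ paramInterval,
      η x = η 0 + ∫ t in (0 : ℝ)..x, weakDeriv η t := by
  obtain ⟨hc, ⟨-, g, hg, hgL⟩, -⟩ := h
  obtain ⟨h1, h2⟩ := weakDeriv_spec hgL hg
  exact ⟨h1, h2.eq_primitive hc (intervalIntegrable_of_memLp h1)⟩

theorem norm_tangent {γ : ℝ → Plane} {x : ℝ} (h : dx γ x ≠ 0) : ‖tangent γ x‖ = 1 := by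
  rw [tangent, norm_smul, norm_inv, norm_norm, inv_mul_cancel₀ (norm_ne_zero_iff.2 h)]

/-- Reparametrization of an admissible pair by arc length. -/
theorem exists_tangentDirector_of_admissible {δ lam c A : ℝ} (hc : 0 < c) {γ η : ℝ → Plane}
    (h : (γ, η) ∈ admissible (2 * Real.pi * c) A) :
    ∃ T N p q, IsTangentDirector c A T N p q ∧
      reducedEnergy δ lam c T p q = energy δ lam γ η := by
  obtain ⟨hγ, hη, hL, hA, hunit⟩ := h
  obtain ⟨hpL, hτ⟩ := tangent_spec hγ
  obtain ⟨hqL, hN⟩ := director_spec hη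
  obtain ⟨hC, -, hne, hper, hdper⟩ := hγ
  simp only at hpL hτ hqL hN hC hne hper hdper hL hA hunit
  have hv := continuousOn_dx hC
  set p := weakDeriv (tangent γ) with hp
  set q := weakDeriv η with hq
  -- Extending the speed constantly beyond the end points makes it continuous and positive on the
  -- whole line, so that `arcParam` is strictly increasing everywhere.
  set w : ℝ → ℝ := IccExtend two_pi_pos.le (fun x : Icc 0 (2 * Real.pi) => ‖dx γ x‖) with hwdef
  have hw : Continuous w := (continuousOn_iff_continuous_domRestrict.1 hv.norm).Icc_extend'
  have hwv : ∀ x ∈ paramInterval, w x = ‖dx γ x‖ := fun x hx => IccExtend_of_mem _ _ hx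
  have hpos : ∀ x, 0 < w x := fun x => norm_pos_iff.2 (hne _ (projIcc _ _ _ x).2)
  have hwint : ∀ x ∈ paramInterval, ∀ f : ℝ → ℝ,
      ∫ t in (0 : ℝ)..x, f t * w t = ∫ t in (0 : ℝ)..x, f t * ‖dx γ t‖ := fun x hx f =>
    intervalIntegral.integral_congr fun t ht => by
      simp only [hwv t (uIcc_zero_subset_param hx ht)]
  have hs2 : arcParam w c (2 * Real.pi) = 2 * Real.pi := by
    have := hwint _ two_pi_mem_param (fun _ => 1)
    simp only [one_mul] at this
    rw [arcParam, this, ← length, hL]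
    field_simp
  set s := arcParam w c with hs
  set σ := arcInv w c with hσ
  have hσs : ∀ x, σ (s x) = x := arcInv_arcParam hw hpos hc
  have hs0 : s 0 = 0 := arcParam_zero
  have hσ0 : σ 0 = 0 := by rw [← hs0, hσs, hs0]
  have hσ2 : σ (2 * Real.pi) = 2 * Real.pi := by rw [← hs2, hσs, hs2]
  have hsurj : ∀ y ∈ paramInterval, ∃ x ∈ paramInterval, s x = y := by
    intro y hy
    have := image_arcParam hw hpos hc two_pi_pos.le
    rw [← hs, hs2] at this
    rw [paramInterval, ← this] at hy
    exact hy
  have hcvE : ∀ F : ℝ → Plane, ∀ x ∈ paramInterval, ∫ y in (0 : ℝ)..s x, F (σ y) =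
      ∫ t in (0 : ℝ)..x, (c⁻¹ * w t) • F t := fun F x hx =>
    integral_comp_arcInv hw hpos hc F hx.1
  -- The chain rule for `u ∘ σ` in integrated form; the factor `c / |dx γ|` is the derivative of
  -- `σ`.
  have hprim : ∀ u g : ℝ → Plane, (∀ x ∈ paramInterval, u x = u 0 + ∫ t in (0 : ℝ)..x, g t) →
      ∀ y ∈ paramInterval, u (σ y) = u (σ 0) +
        ∫ t in (0 : ℝ)..y, (fun x => c • ‖dx γ x‖⁻¹ • g x) (σ t) := by
    intro u g hu y hy
    obtain ⟨x, hx, rfl⟩ := hsurj y hy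
    beta_reduce
    rw [hcvE (fun x => c • ‖dx γ x‖⁻¹ • g x) x hx, hσs, hσ0, hu x hx]
    congr 1
    refine intervalIntegral.integral_congr fun t ht => ?_
    have ht' := uIcc_zero_subset_param hx ht
    have : ‖dx γ t‖ ≠ 0 := norm_ne_zero_iff.2 (hne t ht')
    simp only [hwv t ht', smul_smul]
    rw [show c⁻¹ * ‖dx γ t‖ * (c * ‖dx γ t‖⁻¹) = 1 by field_simp, one_smul]
  have hmem : ∀ g : ℝ → Plane, MemLp g 2 paramMeasure →
      MemLp (fun y => (fun x => c • ‖dx γ x‖⁻¹ • g x) (σ y)) 2 paramMeasure := fun g hg =>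
    memLp_comp_arcInv hw hpos hc hs2
      ((memLp_smul_of_continuousOn (hv.norm.inv₀ fun x hx => norm_ne_zero_iff.2 (hne x hx))
        hg).const_smul c)
  have hT : ∀ x ∈ paramInterval,
      ∫ t in (0 : ℝ)..s x, tangent γ (σ t) = c⁻¹ • (γ x - γ 0) := by
    intro x hx
    rw [hcvE (tangent γ) x hx, eq_primitive_dx hC x hx, add_sub_cancel_left,
      ← intervalIntegral.integral_smul]
    refine intervalIntegral.integral_congr fun t ht => ?_
    have ht' := uIcc_zero_subset_param hx ht
    have : ‖dx γ t‖ ≠ 0 := norm_ne_zero_iff.2 (hne t ht')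
    simp only [hwv t ht', tangent, smul_smul]
    rw [mul_assoc, mul_inv_cancel₀ this, mul_one]
  have hcv : ∀ F : ℝ → ℝ, ∫ y in (0 : ℝ)..(2 * Real.pi), F (σ y) =
      c⁻¹ * ∫ x in (0 : ℝ)..(2 * Real.pi), F x * ‖dx γ x‖ := by
    intro F
    have := integral_comp_arcInv hw hpos hc F two_pi_pos.le
    rw [← hs, hs2] at this
    rw [this, ← hwint _ two_pi_mem_param, ← intervalIntegral.integral_const_mul]
    refine intervalIntegral.integral_congr fun t _ => ?_
    simp only [smul_eq_mul]; ring
  refine ⟨fun y => tangent γ (σ y), fun y => η (σ y),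
    fun y => (fun x => c • ‖dx γ x‖⁻¹ • p x) (σ y),
    fun y => (fun x => c • ‖dx γ x‖⁻¹ • q x) (σ y),
    ⟨hmem p hpL, hmem q hqL, hprim _ _ hτ, hprim _ _ hN, ?_, ?_, ?_, ?_, ?_, ?_⟩, ?_⟩
  · intro y hy
    obtain ⟨x, hx, rfl⟩ := hsurj y hy
    simp only [hσs]
    exact norm_tangent (hne x hx)
  · intro y hy
    obtain ⟨x, hx, rfl⟩ := hsurj y hy
    simp only [hσs]
    have := hunit x hx
    rw [unitDefect, sub_eq_zero] at this
    exact (pow_eq_one_iff_of_nonneg (norm_nonneg _) two_ne_zero).1 this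
  · simp only [hσ0, hσ2, tangent, hdper]
  · simp only [hσ0, hσ2]
    exact hη.2.2
  · have := hT _ two_pi_mem_param
    rwa [hs2, ← hper, sub_self, smul_zero] at this
  · have hF : ∀ y ∈ paramInterval,
        inner ℝ (∫ t in (0 : ℝ)..y, tangent γ (σ t)) (rot (tangent γ (σ y))) =
          (fun x => inner ℝ (c⁻¹ • (γ x - γ 0)) (rot (tangent γ x))) (σ y) := by
      intro y hy
      obtain ⟨x, hx, rfl⟩ := hsurj y hy
      simp only [hσs, hT x hx]
    rw [intervalIntegral.integral_congr fun y hy => hF y (uIcc_param ▸ hy)]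
    beta_reduce
    rw [hcv fun x => inner ℝ (c⁻¹ • (γ x - γ 0)) (rot (tangent γ x))]
    have hv' : ContinuousOn (dx γ) (uIcc 0 (2 * Real.pi)) := uIcc_param ▸ hv
    have hγ' : ContinuousOn γ (uIcc 0 (2 * Real.pi)) := uIcc_param ▸ hC.continuousOn
    have hv0 : ∫ x in (0 : ℝ)..(2 * Real.pi), dx γ x = 0 := by
      have := eq_primitive_dx hC _ two_pi_mem_param
      rw [← hper] at this
      exact left_eq_add.1 this
    -- Because the curve is closed, moving its base point to the origin does not change the area.
    have hz : ∫ x in (0 : ℝ)..(2 * Real.pi), inner ℝ (γ 0) (rot (dx γ x)) = 0 := by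
      have := (((innerSL ℝ (γ 0)).comp rotL : Plane →L[ℝ] ℝ)).intervalIntegral_comp_comm
        (hv'.intervalIntegrable (μ := volume))
      rw [hv0, map_zero] at this
      exact this
    have e : ∀ x ∈ uIcc 0 (2 * Real.pi),
        inner ℝ (c⁻¹ • (γ x - γ 0)) (rot (tangent γ x)) * ‖dx γ x‖ =
          c⁻¹ * (inner ℝ (γ x) (rot (dx γ x)) - inner ℝ (γ 0) (rot (dx γ x))) := by
      intro x hx
      have : ‖dx γ x‖ ≠ 0 := norm_ne_zero_iff.2 (hne x (uIcc_param ▸ hx))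
      rw [tangent, rot_smul, real_inner_smul_left, real_inner_smul_right, inner_sub_left]
      field_simp
    rw [intervalIntegral.integral_congr e, intervalIntegral.integral_const_mul,
      intervalIntegral.integral_sub
        (hγ'.inner (continuous_rot.comp_continuousOn hv')).intervalIntegrable
        (continuousOn_const.inner (continuous_rot.comp_continuousOn hv')).intervalIntegrable,
      hz, sub_zero, ← hA, area]
    field_simp
  · rw [reducedEnergy, energy, curveIntegral, curveIntegral]
    have e1 := hcv fun x => (c * (curvature γ x + δ * divergence γ η x)) ^ 2
    have e2 := hcv fun x => ‖c • arcDeriv γ η x‖ ^ 2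
    have e3 : ∀ x ∈ uIcc 0 (2 * Real.pi), normSq (gradient γ η x) * ‖dx γ x‖ =
        ‖arcDeriv γ η x‖ ^ 2 * ‖dx γ x‖ := fun x hx => by
      rw [normSq_gradient, norm_tangent (hne x (uIcc_param ▸ hx)), one_pow, mul_one]
    have e4 : ∀ y, bendingDensity δ (fun y => tangent γ (σ y))
        (fun y => (fun x => c • ‖dx γ x‖⁻¹ • p x) (σ y))
        (fun y => (fun x => c • ‖dx γ x‖⁻¹ • q x) (σ y)) y =
        c * (curvature γ (σ y) + δ * divergence γ η (σ y)) := fun y => by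
      simp only [bendingDensity, curvature, divergence, arcDeriv, normal, ← hp, ← hq,
        real_inner_smul_left]
      ring
    rw [intervalIntegral.integral_congr e3]
    simp only [e4]
    rw [e1]
    simp only [arcDeriv, ← hq] at e2 ⊢
    rw [e2]
    simp only [mul_pow, norm_smul, Real.norm_eq_abs, sq_abs, mul_assoc,
      intervalIntegral.integral_const_mul]
    field_simp

theorem ae_param_of_forall {P : ℝ → Prop} (h : ∀ x ∈ paramInterval, P x) :
    ∀ᵐ x ∂paramMeasure, P x :=
  ae_restrict_of_forall_mem measurableSet_Ioo fun x hx => h x (Ioo_subset_Icc_self hx)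

theorem dx_eq_of_hasDerivAt {γ : ℝ → Plane} {v : Plane} {x : ℝ} (hx : x ∈ paramInterval)
    (h : HasDerivAt γ v x) : dx γ x = v :=
  h.hasDerivWithinAt.derivWithin (uniqueDiffOn_Icc two_pi_pos x hx)

/-- A criterion for membership in `HImm2` for curves which are defined on the whole line. -/
theorem mem_HImm2_of_hasDerivAt {γ v g : ℝ → Plane} (hγ : ∀ x, HasDerivAt γ (v x) x)
    (hv : Continuous v) (hg : MemLp g 2 paramMeasure)
    (hvg : ∀ x ∈ paramInterval, v x = v 0 + ∫ t in (0 : ℝ)..x, g t)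
    (hne : ∀ x ∈ paramInterval, v x ≠ 0) (hper : γ 0 = γ (2 * Real.pi))
    (hvper : v 0 = v (2 * Real.pi)) : γ ∈ HImm2 := by
  have hd : ∀ x ∈ paramInterval, dx γ x = v x := fun x hx => dx_eq_of_hasDerivAt hx (hγ x)
  have hγc : Continuous γ := continuous_iff_continuousAt.2 fun x => (hγ x).continuousAt
  have hC : ContDiff ℝ 1 γ := by
    rw [contDiff_one_iff_deriv, (funext fun x => (hγ x).deriv : deriv γ = v)]
    exact ⟨fun x => (hγ x).differentiableAt, hv⟩
  refine ⟨hC.contDiffOn, ⟨memLp_of_continuousOn hγc.continuousOn, v, ?_,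
    memLp_of_continuousOn hv.continuousOn, g,
    isWeakDeriv_of_eq_primitive (intervalIntegrable_of_memLp hg) hvg, hg⟩, ?_, hper, ?_⟩
  · refine isWeakDeriv_of_eq_primitive (hv.intervalIntegrable _ _) fun x hx => ?_
    rw [intervalIntegral.integral_eq_sub_of_hasDerivAt (fun t _ => hγ t)
      (hv.intervalIntegrable _ _)]
    abel
  · intro x hx
    rw [hd x hx]; exact hne x hx
  · rw [hd _ zero_mem_param, hd _ two_pi_mem_param, hvper]

theorem mem_HPer1_of_eq_primitive {η q : ℝ → Plane} (hq : MemLp q 2 paramMeasure)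
    (h : ∀ x ∈ paramInterval, η x = η 0 + ∫ t in (0 : ℝ)..x, q t)
    (hper : η 0 = η (2 * Real.pi)) : η ∈ HPer1 := by
  have hqi := intervalIntegrable_of_memLp hq
  have hc := continuousOn_of_eq_primitive hqi h
  exact ⟨hc, ⟨memLp_of_continuousOn hc, q, isWeakDeriv_of_eq_primitive hqi h, hq⟩, hper⟩

/-- Reconstruction of an admissible pair from tangent and director. -/
theorem exists_admissible_of_tangentDirector {δ lam c A : ℝ} (hc : 0 < c) {T N p q : ℝ → Plane}
    (h : IsTangentDirector c A T N p q) :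
    ∃ r ∈ admissible (2 * Real.pi * c) A, energy δ lam r.1 r.2 = reducedEnergy δ lam c T p q := by
  have hTc : ContinuousOn T paramInterval :=
    continuousOn_of_eq_primitive (intervalIntegrable_of_memLp h.memLp_p) h.T_eq
  -- With a continuous extension of `T`, the curve is differentiable on the whole line, and its
  -- one-sided derivatives at the end points need no separate argument.
  set S : ℝ → Plane := IccExtend two_pi_pos.le (fun x : Icc 0 (2 * Real.pi) => T x) with hS
  have hSc : Continuous S := (continuousOn_iff_continuous_domRestrict.1 hTc).Icc_extend'
  have hST : ∀ x ∈ paramInterval, S x = T x := fun x hx => IccExtend_of_mem _ _ hx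
  have hSint : ∀ x ∈ paramInterval, ∫ t in (0 : ℝ)..x, S t = ∫ t in (0 : ℝ)..x, T t :=
    fun x hx => intervalIntegral.integral_congr fun t ht => hST t (uIcc_zero_subset_param hx ht)
  set γ : ℝ → Plane := fun x => c • ∫ t in (0 : ℝ)..x, S t with hγ
  have hγd : ∀ x, HasDerivAt γ (c • S x) x := fun x =>
    ((hSc.integral_hasStrictDerivAt 0 x).hasDerivAt).const_smul c
  have hdx : ∀ x ∈ paramInterval, dx γ x = c • T x := fun x hx => by
    rw [dx_eq_of_hasDerivAt hx (hγd x), hST x hx]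
  have hnorm : ∀ x ∈ paramInterval, ‖dx γ x‖ = c := fun x hx => by
    rw [hdx x hx, norm_smul, h.norm_T x hx, mul_one, Real.norm_of_nonneg hc.le]
  have htan : ∀ x ∈ paramInterval, tangent γ x = T x := fun x hx => by
    rw [tangent, hnorm x hx, hdx x hx, smul_smul, inv_mul_cancel₀ hc.ne', one_smul]
  have hp : weakDeriv (tangent γ) =ᵐ[paramMeasure] p :=
    weakDeriv_ae_eq h.memLp_p (isWeakDeriv_of_eq_primitive (intervalIntegrable_of_memLp h.memLp_p)
      fun x hx => by rw [htan x hx, htan 0 zero_mem_param, h.T_eq x hx])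
  have hq : weakDeriv N =ᵐ[paramMeasure] q :=
    weakDeriv_ae_eq h.memLp_q (isWeakDeriv_of_eq_primitive (intervalIntegrable_of_memLp h.memLp_q)
      h.N_eq)
  refine ⟨(γ, N), ⟨?_, mem_HPer1_of_eq_primitive h.memLp_q h.N_eq h.N_per, ?_, ?_, ?_⟩, ?_⟩
  · refine mem_HImm2_of_hasDerivAt (g := fun x => c • p x) hγd (hSc.const_smul c)
      (h.memLp_p.const_smul c) (fun x hx => ?_) (fun x hx => ?_) ?_ ?_
    · rw [hST x hx, hST 0 zero_mem_param, h.T_eq x hx, smul_add, intervalIntegral.integral_smul]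
    · rw [hST x hx, smul_ne_zero_iff]
      exact ⟨hc.ne', norm_ne_zero_iff.1 (by rw [h.norm_T x hx]; exact one_ne_zero)⟩
    · simp only [hγ]
      rw [hSint _ two_pi_mem_param, h.closed, intervalIntegral.integral_same]
    · rw [hST _ zero_mem_param, hST _ two_pi_mem_param, h.T_per]
  · rw [length, intervalIntegral.integral_congr (g := fun _ => c) fun x hx =>
      hnorm x (uIcc_param ▸ hx), intervalIntegral.integral_const, sub_zero, smul_eq_mul]
  · rw [area, intervalIntegral.integral_congr (g := fun x => c ^ 2 *
      inner ℝ (∫ t in (0 : ℝ)..x, T t) (rot (T x))), intervalIntegral.integral_const_mul,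
      ← mul_assoc, h.area_eq]
    intro x hx
    have hx' : x ∈ paramInterval := uIcc_param ▸ hx
    have hγx : γ x = c • ∫ t in (0 : ℝ)..x, T t := by simp only [hγ, hSint x hx']
    simp only [hdx x hx', hγx, rot_smul, real_inner_smul_left, real_inner_smul_right]
    ring
  · intro x hx
    simp [unitDefect, h.norm_N x hx]
  · rw [energy, curveIntegral, curveIntegral, reducedEnergy]
    simp only [integral_param_eq]
    rw [integral_congr_ae
        (f := fun x => (curvature γ x + δ * divergence γ N x) ^ 2 * ‖dx γ x‖)
        (g := fun x => c⁻¹ * bendingDensity δ T p q x ^ 2),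
      integral_congr_ae (f := fun x => normSq (gradient γ N x) * ‖dx γ x‖)
        (g := fun x => c⁻¹ * ‖q x‖ ^ 2), integral_const_mul, integral_const_mul]
    · field_simp
    · filter_upwards [hq, ae_param_of_forall hnorm, ae_param_of_forall htan,
        ae_param_of_forall h.norm_T] with x h1 h2 h3 h4
      rw [normSq_gradient, h3, h4, arcDeriv, h1, h2, norm_smul, norm_inv,
        Real.norm_of_nonneg hc.le]
      field_simp
    · filter_upwards [hp, hq, ae_param_of_forall hnorm, ae_param_of_forall htan] with x h0 h1 h2 h3
      simp only [curvature, divergence, normal, arcDeriv, h0, h1, h2, h3, bendingDensity,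
        real_inner_smul_left]
      field_simp

/-! ### Weak convergence in Hilbert spaces -/

section Hilbert

variable {H : Type*} [NormedAddCommGroup H] [InnerProductSpace ℝ H]

/-- Bounded sequences in a separable Hilbert space have weakly convergent subsequences. -/
theorem exists_subseq_tendsto_inner [CompleteSpace H] [TopologicalSpace.SeparableSpace H]
    {u : ℕ → H} {R : ℝ} (h : ∀ n, ‖u n‖ ≤ R) :
    ∃ (v : H) (φ : ℕ → ℕ), StrictMono φ ∧
      ∀ z, Tendsto (fun n => inner ℝ (u (φ n)) z) atTop (𝓝 (inner ℝ v z)) := by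
  -- Sequential Banach–Alaoglu in the dual, transported by the Riesz isomorphism.
  obtain ⟨ℓ, -, φ, hφ, hl⟩ := WeakDual.isSeqCompact_closedBall ℝ H 0 R
    (x := fun n => StrongDual.toWeakDual (InnerProductSpace.toDual ℝ H (u n)))
    (fun n => by
      simpa using h n)
  refine ⟨(InnerProductSpace.toDual ℝ H).symm (WeakDual.toStrongDual ℓ), φ, hφ, fun z => ?_⟩
  have := ((WeakDual.eval_continuous z).tendsto ℓ).comp hl
  rw [InnerProductSpace.toDual_symm_apply]
  exact this

/-- Split `z n = y + (z n - y)`: weak convergence handles the first term, boundedness of `u` the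
second. -/
theorem tendsto_inner_of_weak_of_strong {u z : ℕ → H} {v y : H} {R : ℝ} (hR : ∀ n, ‖u n‖ ≤ R)
    (hu : ∀ z, Tendsto (fun n => inner ℝ (u n) z) atTop (𝓝 (inner ℝ v z)))
    (hz : Tendsto z atTop (𝓝 y)) :
    Tendsto (fun n => inner ℝ (u n) (z n)) atTop (𝓝 (inner ℝ v y)) := by
  have h0 : Tendsto (fun n => inner ℝ (u n) (z n - y)) atTop (𝓝 0) := by
    have : Tendsto (fun n => R * ‖z n - y‖) atTop (𝓝 0) := by
      simpa using (tendsto_iff_norm_sub_tendsto_zero.1 hz).const_mul R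
    exact squeeze_zero_norm (fun n => (norm_inner_le_norm _ _).trans
      (mul_le_mul_of_nonneg_right (hR n) (norm_nonneg _))) this
  have := (hu y).add h0
  simpa [← inner_add_right] using this

end Hilbert

/-! ### Weak and strong convergence in L² -/

section L2

theorem inner_toLp {f g : ℝ → Plane} (hf : MemLp f 2 paramMeasure) (hg : MemLp g 2 paramMeasure) :
    inner ℝ (hf.toLp f) (hg.toLp g) = ∫ x, inner ℝ (f x) (g x) ∂paramMeasure := by
  rw [L2.inner_def]
  refine integral_congr_ae ?_
  filter_upwards [hf.coeFn_toLp, hg.coeFn_toLp] with x h1 h2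
  rw [h1, h2]

theorem norm_toLp_sq {f : ℝ → Plane} (hf : MemLp f 2 paramMeasure) :
    ‖hf.toLp f‖ ^ 2 = ∫ x, ‖f x‖ ^ 2 ∂paramMeasure := by
  rw [← real_inner_self_eq_norm_sq, inner_toLp]
  simp only [real_inner_self_eq_norm_sq]

theorem integrable_norm_sq {E : Type*} [NormedAddCommGroup E] {f : ℝ → E}
    (hf : MemLp f 2 paramMeasure) : Integrable (fun x => ‖f x‖ ^ 2) paramMeasure :=
  (memLp_two_iff_integrable_sq_norm hf.1).1 hf

theorem memLp_inner_of_continuousOn {p V : ℝ → Plane} (hp : MemLp p 2 paramMeasure)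
    (hV : ContinuousOn V paramInterval) : MemLp (fun x => inner ℝ (p x) (V x)) 2 paramMeasure := by
  obtain ⟨C, hC⟩ := isCompact_Icc.exists_bound_of_continuousOn hV
  refine hp.of_le_mul (c := C) (hp.1.inner ((hV.mono Ioo_subset_Icc_self).aestronglyMeasurable
    measurableSet_Ioo)) (ae_param_of_forall fun x hx => ?_)
  rw [mul_comm]
  exact (norm_inner_le_norm _ _).trans (mul_le_mul_of_nonneg_left (hC x hx) (norm_nonneg _))

theorem memLp_smul_continuousOn {ψ : ℝ → ℝ} {V : ℝ → Plane} (hψ : MemLp ψ 2 paramMeasure)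
    (hV : ContinuousOn V paramInterval) : MemLp (fun x => ψ x • V x) 2 paramMeasure := by
  obtain ⟨C, hC⟩ := isCompact_Icc.exists_bound_of_continuousOn hV
  refine hψ.of_le_mul (c := C) (hψ.1.smul ((hV.mono Ioo_subset_Icc_self).aestronglyMeasurable
    measurableSet_Ioo)) (ae_param_of_forall fun x hx => ?_)
  rw [norm_smul, mul_comm]
  exact mul_le_mul_of_nonneg_right (hC x hx) (norm_nonneg _)

/-- Dominated convergence with majorant `4|ψ|²`, as `|V n - W| ≤ 2`. Pointwise convergence of the
tangents thus suffices for strong convergence, even though the weight `ψ` is merely square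
integrable. -/
theorem tendsto_toLp_smul {ψ : ℝ → ℝ} {V : ℕ → ℝ → Plane} {W : ℝ → Plane}
    (hψ : MemLp ψ 2 paramMeasure) (hV : ∀ n, ContinuousOn (V n) paramInterval)
    (hW : ContinuousOn W paramInterval) (hV1 : ∀ n, ∀ x ∈ paramInterval, ‖V n x‖ ≤ 1)
    (hW1 : ∀ x ∈ paramInterval, ‖W x‖ ≤ 1)
    (h : ∀ x ∈ paramInterval, Tendsto (fun n => V n x) atTop (𝓝 (W x))) :
    Tendsto (fun n => (memLp_smul_continuousOn hψ (hV n)).toLp _) atTop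
      (𝓝 ((memLp_smul_continuousOn hψ hW).toLp _)) := by
  rw [tendsto_iff_norm_sub_tendsto_zero]
  have hd : ∀ n, MemLp (fun x => ψ x • (V n x - W x)) 2 paramMeasure := fun n =>
    memLp_smul_continuousOn hψ ((hV n).sub hW)
  have e : ∀ n, ‖(memLp_smul_continuousOn hψ (hV n)).toLp _ -
      (memLp_smul_continuousOn hψ hW).toLp _‖ =
        Real.sqrt (∫ x, ‖ψ x • (V n x - W x)‖ ^ 2 ∂paramMeasure) := by
    intro n
    rw [← norm_toLp_sq (hd n), Real.sqrt_sq (norm_nonneg _), ← MemLp.toLp_sub]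
    congr 2
    ext x
    simp [smul_sub]
  simp only [e]
  rw [← Real.sqrt_zero]
  refine (Real.continuous_sqrt.tendsto 0).comp ?_
  rw [← integral_zero ℝ ℝ (μ := paramMeasure)]
  refine tendsto_integral_of_dominated_convergence (fun x => 4 * ‖ψ x‖ ^ 2)
    (fun n => (integrable_norm_sq (hd n)).1) ((integrable_norm_sq hψ).const_mul 4)
    (fun n => ae_param_of_forall fun x hx => ?_) (ae_param_of_forall fun x hx => ?_)
  · have h2 : ‖V n x - W x‖ ≤ 2 := by
      linarith [norm_sub_le (V n x) (W x), hV1 n x hx, hW1 x hx]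
    rw [Real.norm_of_nonneg (by positivity), norm_smul, mul_pow, mul_comm]
    have : ‖V n x - W x‖ ^ 2 ≤ 4 := by nlinarith [norm_nonneg (V n x - W x)]
    gcongr
  · have := (((h x hx).sub_const (W x)).const_smul (ψ x)).norm.pow 2
    simpa using this

theorem tendsto_plane_of_inner {a : ℕ → Plane} {b : Plane}
    (h : ∀ e : Plane, Tendsto (fun n => inner ℝ e (a n)) atTop (𝓝 (inner ℝ e b))) :
    Tendsto a atTop (𝓝 b) := by
  rw [(EuclideanSpace.equiv (Fin 2) ℝ).toHomeomorph.isInducing.tendsto_nhds_iff, tendsto_pi_nhds]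
  intro i
  have := h (EuclideanSpace.single i 1)
  simp only [EuclideanSpace.inner_single_left, map_one, one_mul] at this
  exact this

theorem integral_primitive_eq {f : ℝ → Plane} {x : ℝ} (hx : x ∈ paramInterval) :
    ∫ t in (0 : ℝ)..x, f t = ∫ t in Ioo 0 x, f t ∂paramMeasure := by
  rw [intervalIntegral.integral_of_le hx.1, integral_Ioc_eq_integral_Ioo, paramMeasure,
    Measure.restrict_restrict measurableSet_Ioo,
    inter_eq_left.2 (Ioo_subset_Ioo_right hx.2)]

/-- Weak convergence is tested against the indicator of `(0, x)` times a fixed vector. -/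
theorem tendsto_primitive_of_weak {p : ℕ → ℝ → Plane} (hp : ∀ n, MemLp (p n) 2 paramMeasure)
    {P : Lp Plane 2 paramMeasure}
    (h : ∀ z, Tendsto (fun n => inner ℝ ((hp n).toLp (p n)) z) atTop (𝓝 (inner ℝ P z)))
    {x : ℝ} (hx : x ∈ paramInterval) :
    Tendsto (fun n => ∫ t in (0 : ℝ)..x, p n t) atTop (𝓝 (∫ t in (0 : ℝ)..x, P t)) := by
  refine tendsto_plane_of_inner fun e => ?_
  have hm : paramMeasure (Ioo 0 x) ≠ ⊤ := measure_ne_top _ _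
  have := h (indicatorConstLp 2 measurableSet_Ioo hm e)
  simp only [real_inner_comm (indicatorConstLp 2 measurableSet_Ioo hm e),
    L2.inner_indicatorConstLp_eq_inner_setIntegral] at this
  rw [integral_primitive_eq hx]
  refine this.congr fun n => ?_
  rw [integral_primitive_eq hx]
  congr 1
  exact integral_congr_ae (ae_restrict_of_ae (hp n).coeFn_toLp)

end L2

/-! ### Coercivity, closedness and lower semicontinuity -/

namespace IsTangentDirector

variable {δ lam c A : ℝ} {T N p q : ℝ → Plane}

theorem continuousOn_T (h : IsTangentDirector c A T N p q) : ContinuousOn T paramInterval :=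
  continuousOn_of_eq_primitive (intervalIntegrable_of_memLp h.memLp_p) h.T_eq

theorem continuousOn_rot_T (h : IsTangentDirector c A T N p q) :
    ContinuousOn (fun x => rot (T x)) paramInterval :=
  continuous_rot.comp_continuousOn h.continuousOn_T

theorem memLp_bendingDensity (h : IsTangentDirector c A T N p q) :
    MemLp (bendingDensity δ T p q) 2 paramMeasure :=
  (memLp_inner_of_continuousOn h.memLp_p h.continuousOn_rot_T).add
    ((memLp_inner_of_continuousOn h.memLp_q h.continuousOn_T).const_mul δ)

/-- Differentiate `|T|² = 1`. -/
theorem inner_p_T (h : IsTangentDirector c A T N p q) :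
    ∀ᵐ x ∂paramMeasure, inner ℝ (p x) (T x) = 0 := by
  rw [paramMeasure, ae_restrict_iff' measurableSet_Ioo]
  filter_upwards [ae_hasDerivAt_of_eq_primitive (intervalIntegrable_of_memLp h.memLp_p) h.T_eq]
    with x hx hxI
  have hd := hx (uIcc_param ▸ Ioo_subset_Icc_self hxI)
  have h1 := hd.norm_sq
  have h2 : HasDerivAt (fun y => ‖T y‖ ^ 2) 0 x := by
    refine (hasDerivAt_const x (1 : ℝ)).congr_of_eventuallyEq ?_
    filter_upwards [Ioo_mem_nhds hxI.1 hxI.2] with y hy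
    rw [h.norm_T y (Ioo_subset_Icc_self hy), one_pow]
  have := h1.unique h2
  rw [real_inner_comm]
  linarith

theorem norm_sq_p_le (h : IsTangentDirector c A T N p q) :
    ∀ᵐ x ∂paramMeasure,
      ‖p x‖ ^ 2 ≤ 2 * bendingDensity δ T p q x ^ 2 + 2 * δ ^ 2 * ‖q x‖ ^ 2 := by
  filter_upwards [h.inner_p_T, ae_param_of_forall h.norm_T] with x h1 h2
  have e := norm_sq_mul_norm_sq (p x) (T x)
  rw [h1, h2] at e
  have hq : inner ℝ (q x) (T x) ^ 2 ≤ ‖q x‖ ^ 2 := by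
    rw [← sq_abs]
    have := abs_real_inner_le_norm (q x) (T x)
    rw [h2, mul_one] at this
    gcongr
  have : ‖p x‖ ^ 2 = (bendingDensity δ T p q x - δ * inner ℝ (q x) (T x)) ^ 2 := by
    rw [bendingDensity]; linarith
  rw [this]
  nlinarith [sq_nonneg (bendingDensity δ T p q x + δ * inner ℝ (q x) (T x)),
    mul_le_mul_of_nonneg_left hq (sq_nonneg δ)]

/-- Coercivity. The two energy terms are nonnegative, so each is at most `M`; the second one,
divided by `λ > 0`, controls `q`, and `norm_sq_p_le` then controls `p`. -/
theorem energy_bounds (h : IsTangentDirector c A T N p q) (hc : 0 < c) (hlam : 0 < lam) {M : ℝ}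
    (hM : reducedEnergy δ lam c T p q ≤ M) :
    ‖h.memLp_q.toLp q‖ ^ 2 ≤ 2 * c / lam * M ∧
      ‖h.memLp_p.toLp p‖ ^ 2 ≤ 4 * c * M + 2 * δ ^ 2 * (2 * c / lam * M) := by
  rw [reducedEnergy, integral_param_eq, integral_param_eq] at hM
  rw [norm_toLp_sq, norm_toLp_sq]
  set B := ∫ x, bendingDensity δ T p q x ^ 2 ∂paramMeasure with hB
  set Q := ∫ x, ‖q x‖ ^ 2 ∂paramMeasure with hQ
  have hB0 : 0 ≤ B := integral_nonneg fun x => sq_nonneg _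
  have hQ0 : 0 ≤ Q := integral_nonneg fun x => sq_nonneg _
  have t1 : 0 ≤ 1 / (2 * c) * B := by positivity
  have t2 : 0 ≤ lam / (2 * c) * Q := by positivity
  have hQM : Q ≤ 2 * c / lam * M := by
    calc Q = 2 * c / lam * (lam / (2 * c) * Q) := by field_simp
      _ ≤ 2 * c / lam * M := by gcongr; linarith
  have hBM : B ≤ 2 * c * M := by
    calc B = 2 * c * (1 / (2 * c) * B) := by field_simp
      _ ≤ 2 * c * M := by gcongr; linarith
  refine ⟨hQM, ?_⟩
  have iB : Integrable (fun x => bendingDensity δ T p q x ^ 2) paramMeasure := by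
    simpa using integrable_norm_sq (h.memLp_bendingDensity (δ := δ))
  have := integral_mono_ae (integrable_norm_sq h.memLp_p)
    ((iB.const_mul 2).add ((integrable_norm_sq h.memLp_q).const_mul (2 * δ ^ 2))) h.norm_sq_p_le
  simp only [Pi.add_apply] at this
  rw [integral_add (iB.const_mul 2) ((integrable_norm_sq h.memLp_q).const_mul (2 * δ ^ 2)),
    integral_const_mul, integral_const_mul, ← hB, ← hQ] at this
  nlinarith [mul_le_mul_of_nonneg_left hQM (sq_nonneg δ)]

end IsTangentDirector

/-- The limit of a weakly convergent sequence of tangents and directors. -/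
theorem IsTangentDirector.of_tendsto {c A : ℝ} {T N p q : ℕ → ℝ → Plane}
    (h : ∀ n, IsTangentDirector c A (T n) (N n) (p n) (q n)) {P Q : Lp Plane 2 paramMeasure}
    {T₀ N₀ : Plane}
    (hP : ∀ z, Tendsto (fun n => inner ℝ ((h n).memLp_p.toLp (p n)) z) atTop (𝓝 (inner ℝ P z)))
    (hQ : ∀ z, Tendsto (fun n => inner ℝ ((h n).memLp_q.toLp (q n)) z) atTop (𝓝 (inner ℝ Q z)))
    (hT₀ : Tendsto (fun n => T n 0) atTop (𝓝 T₀)) (hN₀ : Tendsto (fun n => N n 0) atTop (𝓝 N₀)) :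
    IsTangentDirector c A (fun x => T₀ + ∫ t in (0 : ℝ)..x, P t)
      (fun x => N₀ + ∫ t in (0 : ℝ)..x, Q t) P Q ∧
    ∀ x ∈ paramInterval,
      Tendsto (fun n => T n x) atTop (𝓝 (T₀ + ∫ t in (0 : ℝ)..x, P t)) := by
  have hT : ∀ x ∈ paramInterval,
      Tendsto (fun n => T n x) atTop (𝓝 (T₀ + ∫ t in (0 : ℝ)..x, P t)) := fun x hx =>
    (hT₀.add (tendsto_primitive_of_weak _ hP hx)).congr fun n => ((h n).T_eq x hx).symm
  have hN : ∀ x ∈ paramInterval,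
      Tendsto (fun n => N n x) atTop (𝓝 (N₀ + ∫ t in (0 : ℝ)..x, Q t)) := fun x hx =>
    (hN₀.add (tendsto_primitive_of_weak _ hQ hx)).congr fun n => ((h n).N_eq x hx).symm
  set S : ℝ → Plane := fun x => T₀ + ∫ t in (0 : ℝ)..x, P t with hS
  set R : ℝ → Plane := fun x => N₀ + ∫ t in (0 : ℝ)..x, Q t with hR
  have hS0 : ∀ x ∈ paramInterval, S x = S 0 + ∫ t in (0 : ℝ)..x, P t := fun x _ => by simp [hS]
  have hScont : ContinuousOn S paramInterval :=
    continuousOn_of_eq_primitive (intervalIntegrable_of_memLp (Lp.memLp P)) hS0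
  have hTcont : ∀ n, ContinuousOn (T n) paramInterval := fun n => (h n).continuousOn_T
  have hnorm : ∀ x ∈ paramInterval, ‖S x‖ = 1 := fun x hx =>
    tendsto_nhds_unique (hT x hx).norm (by simp only [(h _).norm_T x hx, tendsto_const_nhds])
  have hmeas : ∀ {V : ℝ → Plane} {x : ℝ}, x ∈ paramInterval → ContinuousOn V paramInterval →
      AEStronglyMeasurable V (volume.restrict (uIoc 0 x)) := fun hx hV =>
    (hV.mono (uIoc_subset_uIcc.trans (uIcc_zero_subset_param hx))).aestronglyMeasurable
      measurableSet_uIoc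
  have hint : ∀ x ∈ paramInterval, Tendsto (fun n => ∫ t in (0 : ℝ)..x, T n t) atTop
      (𝓝 (∫ t in (0 : ℝ)..x, S t)) := fun x hx => by
    have hsub := uIoc_subset_uIcc.trans (uIcc_zero_subset_param hx)
    refine intervalIntegral.tendsto_integral_filter_of_dominated_convergence (fun _ => 1)
      (Eventually.of_forall fun n => hmeas hx (hTcont n))
      (Eventually.of_forall fun n => ae_of_all _ fun t ht => ((h n).norm_T t (hsub ht)).le)
      (intervalIntegrable_const) (ae_of_all _ fun t ht => hT t (hsub ht))
  have hprimc : ∀ V : ℝ → Plane, ContinuousOn V paramInterval →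
      ContinuousOn (fun x => ∫ t in (0 : ℝ)..x, V t) paramInterval := fun V hV =>
    continuousOn_of_eq_primitive
      (uIcc_param ▸ hV : ContinuousOn V (uIcc 0 (2 * Real.pi))).intervalIntegrable (by simp)
  refine ⟨⟨Lp.memLp P, Lp.memLp Q, hS0, fun x _ => by simp [hR], hnorm, fun x hx => ?_, ?_, ?_,
    ?_, ?_⟩, hT⟩
  · exact tendsto_nhds_unique (hN x hx).norm
      (by simp only [(h _).norm_N x hx, tendsto_const_nhds])
  · exact tendsto_nhds_unique (hT _ zero_mem_param)
      ((hT _ two_pi_mem_param).congr fun n => (h n).T_per.symm)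
  · exact tendsto_nhds_unique (hN _ zero_mem_param)
      ((hN _ two_pi_mem_param).congr fun n => (h n).N_per.symm)
  · exact tendsto_nhds_unique (hint _ two_pi_mem_param)
      (by simp only [(h _).closed, tendsto_const_nhds])
  -- The area integrand converges pointwise and is bounded by `2π`, since the primitive of a unit
  -- field from `0` has norm at most `x`.
  · have hlim : Tendsto (fun n => ∫ x in (0 : ℝ)..(2 * Real.pi),
        inner ℝ (∫ t in (0 : ℝ)..x, T n t) (rot (T n x))) atTop
        (𝓝 (∫ x in (0 : ℝ)..(2 * Real.pi), inner ℝ (∫ t in (0 : ℝ)..x, S t) (rot (S x)))) := by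
      have hsub := uIoc_subset_uIcc.trans (uIcc_zero_subset_param two_pi_mem_param)
      refine intervalIntegral.tendsto_integral_filter_of_dominated_convergence
        (fun _ => 2 * Real.pi) (Eventually.of_forall fun n => ?_)
        (Eventually.of_forall fun n => ae_of_all _ fun x hx => ?_)
        intervalIntegrable_const (ae_of_all _ fun x hx => ?_)
      · exact (hmeas two_pi_mem_param (hprimc _ (hTcont n))).inner
          (hmeas two_pi_mem_param (h n).continuousOn_rot_T)
      · have hx' := hsub hx
        refine (norm_inner_le_norm _ _).trans ?_
        rw [norm_rot, (h n).norm_T x hx', mul_one]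
        refine (intervalIntegral.norm_integral_le_of_norm_le_const (C := 1) fun t ht =>
          ((h n).norm_T t (uIcc_zero_subset_param hx' (uIoc_subset_uIcc ht))).le).trans ?_
        rw [sub_zero, one_mul, abs_of_nonneg hx'.1]
        exact hx'.2
      · have hx' := hsub hx
        exact (hint x hx').inner ((continuous_rot.tendsto _).comp (hT x hx'))
    exact tendsto_nhds_unique (hlim.const_mul _)
      (by simp only [(h _).area_eq, tendsto_const_nhds])

/-- Lower semicontinuity of the energy. -/
theorem reducedEnergy_le_of_tendsto {δ lam c A : ℝ} (hc : 0 < c) (hlam : 0 < lam)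
    {T N p q : ℕ → ℝ → Plane} (h : ∀ n, IsTangentDirector c A (T n) (N n) (p n) (q n))
    {P Q : Lp Plane 2 paramMeasure} {S R : ℝ → Plane} (hS : IsTangentDirector c A S R P Q)
    (hP : ∀ z, Tendsto (fun n => inner ℝ ((h n).memLp_p.toLp (p n)) z) atTop (𝓝 (inner ℝ P z)))
    (hQ : ∀ z, Tendsto (fun n => inner ℝ ((h n).memLp_q.toLp (q n)) z) atTop (𝓝 (inner ℝ Q z)))
    (hT : ∀ x ∈ paramInterval, Tendsto (fun n => T n x) atTop (𝓝 (S x))) {M m : ℝ}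
    (hMp : ∀ n, ‖(h n).memLp_p.toLp (p n)‖ ≤ M) (hMq : ∀ n, ‖(h n).memLp_q.toLp (q n)‖ ≤ M)
    (hm : Tendsto (fun n => reducedEnergy δ lam c (T n) (p n) (q n)) atTop (𝓝 m)) :
    reducedEnergy δ lam c S P Q ≤ m := by
  set b := bendingDensity δ S P Q with hb
  have hbL : MemLp b 2 paramMeasure := hS.memLp_bendingDensity
  have hPe : P = hS.memLp_p.toLp P := (Lp.toLp_coeFn P _).symm
  have hQe : Q = hS.memLp_q.toLp Q := (Lp.toLp_coeFn Q _).symm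
  -- The limit density `b` is attached to the tangents: `b JTₙ` and `b Tₙ` converge strongly in
  -- `L²`, while `pₙ` and `qₙ` converge weakly. Together they give `∫ b bₙ → ∫ b²`.
  have h1 := tendsto_inner_of_weak_of_strong hMp hP
    (tendsto_toLp_smul hbL (fun n => (h n).continuousOn_rot_T) hS.continuousOn_rot_T
      (fun n x hx => by rw [norm_rot, (h n).norm_T x hx])
      (fun x hx => by rw [norm_rot, hS.norm_T x hx])
      fun x hx => (continuous_rot.tendsto _).comp (hT x hx))
  have h2 := tendsto_inner_of_weak_of_strong hMq hQ
    (tendsto_toLp_smul hbL (fun n => (h n).continuousOn_T) hS.continuousOn_T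
      (fun n x hx => by rw [(h n).norm_T x hx]) (fun x hx => by rw [hS.norm_T x hx]) hT)
  have key : ∀ {T N p q : ℝ → Plane} (h : IsTangentDirector c A T N p q),
      inner ℝ (h.memLp_p.toLp p) ((memLp_smul_continuousOn hbL h.continuousOn_rot_T).toLp _) +
        δ * inner ℝ (h.memLp_q.toLp q) ((memLp_smul_continuousOn hbL h.continuousOn_T).toLp _) =
      ∫ x, b x * bendingDensity δ T p q x ∂paramMeasure := by
    intro T N p q h
    have i1 : Integrable (fun x => b x * inner ℝ (p x) (rot (T x))) paramMeasure :=
      hbL.integrable_mul (memLp_inner_of_continuousOn h.memLp_p h.continuousOn_rot_T)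
    have i2 : Integrable (fun x => b x * inner ℝ (q x) (T x)) paramMeasure :=
      hbL.integrable_mul (memLp_inner_of_continuousOn h.memLp_q h.continuousOn_T)
    rw [inner_toLp, inner_toLp]
    simp only [real_inner_smul_right]
    rw [← integral_const_mul, ← integral_add i1 (i2.const_mul δ)]
    refine integral_congr_ae (ae_of_all _ fun x => ?_)
    simp only [bendingDensity]
    ring
  have h3 := h1.add (h2.const_mul δ)
  have keyS := key hS
  rw [← hPe, ← hQe, ← hb] at keyS
  rw [keyS] at h3
  have h3' := h3.congr fun n => key (h n)
  have h4 := hQ Q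
  rw [real_inner_self_eq_norm_sq] at h4
  have hQn : ‖Q‖ ^ 2 = ∫ x, ‖Q x‖ ^ 2 ∂paramMeasure := by
    conv_lhs => rw [hQe]
    exact norm_toLp_sq _
  have ib : Integrable (fun x => b x * b x) paramMeasure := hbL.integrable_mul hbL
  set β := ∫ x, b x * b x ∂paramMeasure with hβ
  -- Convexity in the form `bₙ² ≥ 2 b bₙ - b²`, and likewise for `qₙ`. The lower bound is linear in
  -- `bₙ` and `qₙ`, and it converges to the energy of the limit.
  have hle : ∀ n, 1 / (2 * c) * (2 * (∫ x, b x * bendingDensity δ (T n) (p n) (q n) x ∂paramMeasure)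
      - β) + lam / (2 * c) * (2 * inner ℝ ((h n).memLp_q.toLp (q n)) Q - ‖Q‖ ^ 2) ≤
      reducedEnergy δ lam c (T n) (p n) (q n) := by
    intro n
    rw [reducedEnergy, integral_param_eq, integral_param_eq, ← norm_toLp_sq (h n).memLp_q]
    have hbn : MemLp (bendingDensity δ (T n) (p n) (q n)) 2 paramMeasure :=
      (h n).memLp_bendingDensity
    have in1 : Integrable (fun x => b x * bendingDensity δ (T n) (p n) (q n) x) paramMeasure :=
      hbL.integrable_mul hbn
    have in2 : Integrable (fun x => bendingDensity δ (T n) (p n) (q n) x ^ 2) paramMeasure := by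
      simpa using integrable_norm_sq hbn
    have e1 : 2 * (∫ x, b x * bendingDensity δ (T n) (p n) (q n) x ∂paramMeasure) - β ≤
        ∫ x, bendingDensity δ (T n) (p n) (q n) x ^ 2 ∂paramMeasure := by
      rw [← integral_const_mul, ← integral_sub (in1.const_mul 2) ib]
      refine integral_mono ((in1.const_mul 2).sub ib) in2 fun x => ?_
      simp only
      nlinarith [sq_nonneg (b x - bendingDensity δ (T n) (p n) (q n) x)]
    have e2 : 2 * inner ℝ ((h n).memLp_q.toLp (q n)) Q - ‖Q‖ ^ 2 ≤
        ‖(h n).memLp_q.toLp (q n)‖ ^ 2 := by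
      nlinarith [real_inner_le_norm ((h n).memLp_q.toLp (q n)) Q,
        sq_nonneg (‖(h n).memLp_q.toLp (q n)‖ - ‖Q‖)]
    have c1 : 0 ≤ 1 / (2 * c) := by positivity
    have c2 : 0 ≤ lam / (2 * c) := by positivity
    exact add_le_add (mul_le_mul_of_nonneg_left e1 c1) (mul_le_mul_of_nonneg_left e2 c2)
  have hlim := (((h3'.const_mul 2).sub_const β).const_mul (1 / (2 * c))).add
    (((h4.const_mul 2).sub_const (‖Q‖ ^ 2)).const_mul (lam / (2 * c)))
  refine (le_of_eq ?_).trans (le_of_tendsto_of_tendsto' hlim hm hle)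
  rw [reducedEnergy, integral_param_eq, integral_param_eq, ← hQn]
  simp only [← hb, sq]
  rw [← hβ]
  ring

/-- The direct method: existence of an optimal pair of tangent and director. -/
theorem exists_optimal_tangentDirector {δ lam c A : ℝ} (hc : 0 < c) (hlam : 0 < lam)
    (hne : ∃ T N p q, IsTangentDirector c A T N p q) :
    ∃ T N p q, IsTangentDirector c A T N p q ∧ ∀ T' N' p' q', IsTangentDirector c A T' N' p' q' →
      reducedEnergy δ lam c T p q ≤ reducedEnergy δ lam c T' p' q' := by
  set E : Set ℝ := {e | ∃ T N p q, IsTangentDirector c A T N p q ∧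
    reducedEnergy δ lam c T p q = e} with hE
  have hEne : E.Nonempty := by
    obtain ⟨T, N, p, q, h⟩ := hne
    exact ⟨_, T, N, p, q, h, rfl⟩
  have hEb : BddBelow E := by
    refine ⟨0, ?_⟩
    rintro _ ⟨T, N, p, q, -, rfl⟩
    rw [reducedEnergy, integral_param_eq, integral_param_eq]
    have hB0 : 0 ≤ ∫ x, bendingDensity δ T p q x ^ 2 ∂paramMeasure :=
      integral_nonneg fun x => sq_nonneg _
    have hQ0 : 0 ≤ ∫ x, ‖q x‖ ^ 2 ∂paramMeasure := integral_nonneg fun x => sq_nonneg _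
    positivity
  obtain ⟨e, -, hetend, heE⟩ := exists_seq_tendsto_sInf hEne hEb
  choose T N p q h he using heE
  obtain ⟨M, hM⟩ := hetend.bddAbove_range
  have hb := fun n => (h n).energy_bounds (δ := δ) hc hlam
    ((he n).le.trans (hM (mem_range_self n)))
  set K := max (Real.sqrt (2 * c / lam * M))
    (Real.sqrt (4 * c * M + 2 * δ ^ 2 * (2 * c / lam * M))) with hK
  have hKq : ∀ n, ‖(h n).memLp_q.toLp (q n)‖ ≤ K := fun n =>
    (Real.le_sqrt_of_sq_le (hb n).1).trans (le_max_left _ _)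
  have hKp : ∀ n, ‖(h n).memLp_p.toLp (p n)‖ ≤ K := fun n =>
    (Real.le_sqrt_of_sq_le (hb n).2).trans (le_max_right _ _)
  -- Separability of `L²` is what makes weak compactness sequential.
  have : SecondCountableTopology (Lp Plane 2 paramMeasure) := by
    have : Fact ((2 : ENNReal) ≠ ⊤) := ⟨ENNReal.ofNat_ne_top⟩
    infer_instance
  obtain ⟨P, φ₁, hφ₁, hP⟩ := exists_subseq_tendsto_inner hKp
  obtain ⟨Q, φ₂, hφ₂, hQ⟩ := exists_subseq_tendsto_inner fun n => hKq (φ₁ n)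
  obtain ⟨T₀, -, φ₃, hφ₃, hT₀⟩ := (isCompact_closedBall (0 : Plane) 1).tendsto_subseq
    (x := fun n => T (φ₁ (φ₂ n)) 0) fun n => by
      simpa using ((h (φ₁ (φ₂ n))).norm_T 0 zero_mem_param).le
  obtain ⟨N₀, -, φ₄, hφ₄, hN₀⟩ := (isCompact_closedBall (0 : Plane) 1).tendsto_subseq
    (x := fun n => N (φ₁ (φ₂ (φ₃ n))) 0) fun n => by
      simpa using ((h (φ₁ (φ₂ (φ₃ n)))).norm_N 0 zero_mem_param).le
  set φ : ℕ → ℕ := fun n => φ₁ (φ₂ (φ₃ (φ₄ n))) with hφ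
  have t1 := hφ₁.tendsto_atTop
  have t2 := hφ₂.tendsto_atTop
  have t34 := (hφ₃.comp hφ₄).tendsto_atTop
  have hP' : ∀ z, Tendsto (fun n => inner ℝ ((h (φ n)).memLp_p.toLp (p (φ n))) z) atTop
      (𝓝 (inner ℝ P z)) := fun z => (hP z).comp (t2.comp t34)
  have hQ' : ∀ z, Tendsto (fun n => inner ℝ ((h (φ n)).memLp_q.toLp (q (φ n))) z) atTop
      (𝓝 (inner ℝ Q z)) := fun z => (hQ z).comp t34
  obtain ⟨hlim, hTt⟩ := IsTangentDirector.of_tendsto (fun n => h (φ n)) hP' hQ'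
    (hT₀.comp hφ₄.tendsto_atTop) hN₀
  refine ⟨_, _, _, _, hlim, fun T' N' p' q' h' => ?_⟩
  refine (reducedEnergy_le_of_tendsto hc hlam (fun n => h (φ n)) hlim hP' hQ' hTt
    (fun n => hKp (φ n)) (fun n => hKq (φ n)) (m := sInf E) ?_).trans
    (csInf_le hEb ⟨T', N', p', q', h', rfl⟩)
  exact (hetend.comp (t1.comp (t2.comp t34))).congr fun n => (he (φ n)).symm

/-! ### Existence of admissible pairs -/

theorem hasDerivAt_plane {f g : ℝ → ℝ} {f' g' x : ℝ} (hf : HasDerivAt f f' x)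
    (hg : HasDerivAt g g' x) :
    HasDerivAt (fun t => (!₂[f t, g t] : Plane)) !₂[f', g'] x := by
  have h : HasDerivAt (fun t => ![f t, g t]) ![f', g'] x :=
    hasDerivAt_pi.2 fun i => by fin_cases i <;> simpa
  exact (EuclideanSpace.equiv (Fin 2) ℝ).symm.toContinuousLinearMap.hasFDerivAt.comp_hasDerivAt x h

theorem norm_plane (a b : ℝ) : ‖(!₂[a, b] : Plane)‖ = Real.sqrt (a ^ 2 + b ^ 2) := by
  rw [← Real.sqrt_sq (norm_nonneg _), plane_norm_sq]
  simp

theorem const_director_mem : (fun _ => !₂[1, 0] : ℝ → Plane) ∈ HPer1 ∧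
    ∀ x ∈ paramInterval, unitDefect (fun _ => !₂[1, 0]) x = 0 := by
  refine ⟨mem_HPer1_of_eq_primitive (q := fun _ => 0) (memLp_const 0) (by simp) rfl, fun x _ => ?_⟩
  rw [unitDefect, norm_plane]
  simp

/-- A criterion for the existence of an admissible pair: a smooth closed curve with the right
isoperimetric quotient. -/
theorem admissible_nonempty_of_curve {L₀ A₀ : ℝ} (hL₀ : 0 < L₀) {x y x' y' x'' y'' : ℝ → ℝ}
    (hx : ∀ t, HasDerivAt x (x' t) t) (hy : ∀ t, HasDerivAt y (y' t) t)
    (hx' : ∀ t, HasDerivAt x' (x'' t) t) (hy' : ∀ t, HasDerivAt y' (y'' t) t)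
    (hx'' : Continuous x'') (hy'' : Continuous y'')
    (hne : ∀ t, x' t ^ 2 + y' t ^ 2 ≠ 0) (px : x 0 = x (2 * Real.pi))
    (py : y 0 = y (2 * Real.pi)) (px' : x' 0 = x' (2 * Real.pi)) (py' : y' 0 = y' (2 * Real.pi))
    {ℓ a : ℝ} (hℓ : ∫ t in (0 : ℝ)..(2 * Real.pi), Real.sqrt (x' t ^ 2 + y' t ^ 2) = ℓ)
    (hℓ0 : 0 < ℓ)
    (ha : 1 / 2 * (∫ t in (0 : ℝ)..(2 * Real.pi), (x t * y' t - y t * x' t)) = a)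
    (hq : a * L₀ ^ 2 = A₀ * ℓ ^ 2) : (admissible L₀ A₀).Nonempty := by
  -- Scaling by `μ` corrects the length; the area `μ² a` is then `A₀` by `hq`.
  set μ := L₀ / ℓ with hμ
  have hμ0 : 0 < μ := div_pos hL₀ hℓ0
  set γ : ℝ → Plane := fun t => !₂[μ * x t, μ * y t] with hγ
  set v : ℝ → Plane := fun t => !₂[μ * x' t, μ * y' t] with hv
  set g : ℝ → Plane := fun t => !₂[μ * x'' t, μ * y'' t] with hg
  have hγd : ∀ t, HasDerivAt γ (v t) t := fun t =>
    hasDerivAt_plane ((hx t).const_mul μ) ((hy t).const_mul μ)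
  have hvd : ∀ t, HasDerivAt v (g t) t := fun t =>
    hasDerivAt_plane ((hx' t).const_mul μ) ((hy' t).const_mul μ)
  have hvc : Continuous v := continuous_iff_continuousAt.2 fun t => (hvd t).continuousAt
  have hgc : Continuous g := by
    refine (EuclideanSpace.equiv (Fin 2) ℝ).symm.continuous.comp
      (f := fun t => ![μ * x'' t, μ * y'' t]) (continuous_pi fun i => ?_)
    fin_cases i
    · exact continuous_const.mul hx''
    · exact continuous_const.mul hy''
  have hnv : ∀ t, ‖v t‖ = μ * Real.sqrt (x' t ^ 2 + y' t ^ 2) := fun t => by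
    rw [hv, norm_plane, mul_pow, mul_pow, ← mul_add, Real.sqrt_mul (sq_nonneg μ),
      Real.sqrt_sq hμ0.le]
  have hd : ∀ t ∈ uIcc 0 (2 * Real.pi), dx γ t = v t := fun t ht =>
    dx_eq_of_hasDerivAt (uIcc_param ▸ ht) (hγd t)
  refine ⟨(γ, fun _ => !₂[1, 0]), ?_, const_director_mem.1, ?_, ?_, const_director_mem.2⟩
  · refine mem_HImm2_of_hasDerivAt (g := g) hγd hvc (memLp_of_continuousOn hgc.continuousOn)
      (fun t _ => ?_) (fun t _ => ?_) ?_ ?_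
    · rw [intervalIntegral.integral_eq_sub_of_hasDerivAt (fun s _ => hvd s)
        (hgc.intervalIntegrable _ _)]
      abel
    · rw [← norm_pos_iff, hnv]
      exact mul_pos hμ0 (Real.sqrt_pos.2 (lt_of_le_of_ne (by positivity) (hne t).symm))
    · simp only [hγ, px, py]
    · simp only [hv, px', py']
  · rw [length, intervalIntegral.integral_congr (g := fun t => μ * Real.sqrt (x' t ^ 2 + y' t ^ 2))
      fun t ht => by simp only [hd t ht, hnv], intervalIntegral.integral_const_mul, hℓ, hμ]
    field_simp
  · rw [area, intervalIntegral.integral_congr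
      (g := fun t => -μ ^ 2 * (x t * y' t - y t * x' t)), intervalIntegral.integral_const_mul]
    · have : A₀ = μ ^ 2 * a := by
        rw [hμ]; field_simp; linarith
      rw [this, ← ha]; ring
    · intro t ht
      beta_reduce
      rw [hd t ht, plane_inner]
      simp only [rot, hγ, hv, Matrix.cons_val_zero, Matrix.cons_val_one]
      ring

theorem continuous_ellipse_length : Continuous fun b : ℝ =>
    ∫ t in (0 : ℝ)..(2 * Real.pi), Real.sqrt ((-Real.sin t) ^ 2 + (b * Real.cos t) ^ 2) :=
  intervalIntegral.continuous_parametric_intervalIntegral_of_continuous' (by fun_prop) _ _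

theorem ellipse_length_pos (b : ℝ) :
    0 < ∫ t in (0 : ℝ)..(2 * Real.pi), Real.sqrt ((-Real.sin t) ^ 2 + (b * Real.cos t) ^ 2) := by
  refine intervalIntegral.integral_pos two_pi_pos (Continuous.continuousOn (by fun_prop))
    (fun t _ => Real.sqrt_nonneg _)
    ⟨Real.pi / 2, ⟨by positivity, by linarith [Real.pi_pos]⟩, ?_⟩
  simp

/-- The ellipses `(cos t, b sin t)` with `b ∈ [-1, 1]` have signed area `πb`, and their
isoperimetric quotient varies continuously between the extreme values `±1/(4π)` of the two oriented
circles. The value zero would force `b = 0`, a segment that is not immersed, so for `A₀ = 0` the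
figure eight `(sin t, sin 2t)` is used. -/
theorem admissible_nonempty {L₀ A₀ : ℝ} (hL₀ : 0 < L₀)
    (hA₀ : A₀ ∈ Icc (-(L₀ ^ 2 / (4 * Real.pi))) (L₀ ^ 2 / (4 * Real.pi))) :
    (admissible L₀ A₀).Nonempty := by
  by_cases hA : A₀ = 0
  · have hpos : 0 < ∫ t in (0 : ℝ)..(2 * Real.pi),
        Real.sqrt (Real.cos t ^ 2 + (2 * Real.cos (2 * t)) ^ 2) := by
      refine intervalIntegral.integral_pos two_pi_pos (Continuous.continuousOn (by fun_prop))
        (fun t _ => Real.sqrt_nonneg _) ⟨0, ⟨le_rfl, two_pi_pos.le⟩, ?_⟩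
      simp
      positivity
    have h2 : ∀ t : ℝ, HasDerivAt (fun t => 2 * t) 2 t := fun t => by
      simpa using (hasDerivAt_id t).const_mul 2
    refine admissible_nonempty_of_curve hL₀ (x := Real.sin) (y := fun t => Real.sin (2 * t))
      (x' := Real.cos) (y' := fun t => 2 * Real.cos (2 * t)) (x'' := fun t => -Real.sin t)
      (y'' := fun t => 2 * (-Real.sin (2 * t) * 2)) (a := 0)
      Real.hasDerivAt_sin (fun t => ?_) Real.hasDerivAt_cos
      (fun t => (((Real.hasDerivAt_cos _).comp t (h2 t)).const_mul 2)) (by fun_prop) (by fun_prop)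
      (fun t => ?_) (by simp) ?_ (by simp) ?_ rfl hpos ?_ (by rw [hA]; ring)
    · have := (Real.hasDerivAt_sin _).comp t (h2 t)
      rwa [mul_comm] at this
    · rw [Real.cos_two_mul]
      nlinarith [sq_nonneg (2 * Real.cos t ^ 2 - 1), sq_nonneg (Real.cos t ^ 2)]
    · rw [mul_zero, Real.sin_zero, show 2 * (2 * Real.pi) = 2 * Real.pi + 2 * Real.pi by ring,
        Real.sin_add_two_pi, Real.sin_two_pi]
    · rw [mul_zero, show 2 * (2 * Real.pi) = 2 * Real.pi + 2 * Real.pi by ring,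
        Real.cos_add_two_pi, Real.cos_two_pi, Real.cos_zero]
    -- The area integrand simplifies to `2 sin t cos² t - 2 sin t`, which has a periodic
    -- antiderivative; the two loops cancel.
    · have hF : ∀ t : ℝ, HasDerivAt (fun t => 2 * Real.cos t - 2 / 3 * Real.cos t ^ 3)
          (Real.sin t * (2 * Real.cos (2 * t)) - Real.sin (2 * t) * Real.cos t) t := fun t => by
        convert! ((Real.hasDerivAt_cos t).const_mul 2).sub
          (((Real.hasDerivAt_cos t).pow 3).const_mul (2 / 3)) using 1
        rw [Real.cos_two_mul, Real.sin_two_mul]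
        simp
        ring
      rw [intervalIntegral.integral_eq_sub_of_hasDerivAt (fun t _ => hF t)
        (Continuous.intervalIntegrable (by fun_prop) _ _)]
      simp
  · set ℓ : ℝ → ℝ := fun b => ∫ t in (0 : ℝ)..(2 * Real.pi),
      Real.sqrt ((-Real.sin t) ^ 2 + (b * Real.cos t) ^ 2) with hℓ
    have hone : ∀ b : ℝ, b ^ 2 = 1 → ℓ b = 2 * Real.pi := fun b hb => by
      simp only [hℓ, mul_pow, hb, neg_sq, one_mul, Real.sin_sq_add_cos_sq, Real.sqrt_one]
      simp
    have hcont : Continuous fun b => Real.pi * b * L₀ ^ 2 - A₀ * ℓ b ^ 2 :=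
      (by fun_prop : Continuous fun b : ℝ => Real.pi * b * L₀ ^ 2).sub
        (continuous_const.mul (continuous_ellipse_length.pow 2))
    have hpi := Real.pi_pos
    have h4 : L₀ ^ 2 = L₀ ^ 2 / (4 * Real.pi) * (4 * Real.pi) := by field_simp
    -- At `b = ±1` the length is `2π`, and the required signs are exactly the two bounds on `A₀`.
    obtain ⟨b, -, hb⟩ : (0 : ℝ) ∈ (fun b => Real.pi * b * L₀ ^ 2 - A₀ * ℓ b ^ 2) '' Icc (-1) 1 := by
      refine intermediate_value_Icc (by norm_num) hcont.continuousOn ⟨?_, ?_⟩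
      · simp only [hone (-1) (by norm_num)]
        rw [h4]
        nlinarith [mul_le_mul_of_nonneg_left hA₀.1 (sq_nonneg (2 * Real.pi))]
      · simp only [hone 1 (by norm_num)]
        rw [h4]
        nlinarith [mul_le_mul_of_nonneg_left hA₀.2 (sq_nonneg (2 * Real.pi))]
    have hb' : Real.pi * b * L₀ ^ 2 = A₀ * ℓ b ^ 2 := sub_eq_zero.1 hb
    have hb0 : b ≠ 0 := by
      rintro rfl
      have : A₀ * ℓ 0 ^ 2 ≠ 0 := mul_ne_zero hA (pow_ne_zero 2 (ellipse_length_pos 0).ne')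
      exact this (by rw [← hb']; ring)
    refine admissible_nonempty_of_curve hL₀ (x := Real.cos) (y := fun t => b * Real.sin t)
      (x' := fun t => -Real.sin t) (y' := fun t => b * Real.cos t) (x'' := fun t => -Real.cos t)
      (y'' := fun t => b * -Real.sin t) (ℓ := ℓ b) (a := Real.pi * b)
      Real.hasDerivAt_cos (fun t => (Real.hasDerivAt_sin t).const_mul b)
      (fun t => (Real.hasDerivAt_sin t).neg) (fun t => (Real.hasDerivAt_cos t).const_mul b)
      (by fun_prop) (by fun_prop) (fun t h0 => ?_) (by simp) (by simp) (by simp) (by simp) rfl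
      (ellipse_length_pos b) ?_ hb'
    · have h1 : Real.sin t = 0 := by nlinarith [sq_nonneg (Real.sin t), sq_nonneg (b * Real.cos t)]
      have h2 : b * Real.cos t = 0 := by
        nlinarith [sq_nonneg (Real.sin t), sq_nonneg (b * Real.cos t)]
      have h3 : Real.cos t = 0 := (mul_eq_zero.1 h2).resolve_left hb0
      have := Real.sin_sq_add_cos_sq t
      rw [h1, h3] at this
      norm_num at this
    · rw [intervalIntegral.integral_congr (g := fun _ => b), intervalIntegral.integral_const]
      · simp; ring
      · intro t _
        have := Real.sin_sq_add_cos_sq t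
        simp only
        linear_combination b * this

end SurfactantCurve

theorem mainTheorem3 (δ lam L₀ A₀ : ℝ) (hlam : 0 < lam) (hL₀ : 0 < L₀)
    (hA₀ : A₀ ∈ Set.Icc (-(L₀ ^ 2 / (4 * Real.pi))) (L₀ ^ 2 / (4 * Real.pi))) :
    ∃ p ∈ SurfactantCurve.admissible L₀ A₀,
      IsMinOn (fun q : (ℝ → SurfactantCurve.Plane) × (ℝ → SurfactantCurve.Plane) =>
        SurfactantCurve.energy δ lam q.1 q.2) (SurfactantCurve.admissible L₀ A₀) p := by
  -- The constant speed of a curve of length `L₀` on an interval of length `2π`.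
  obtain ⟨c, hc, rfl⟩ : ∃ c, 0 < c ∧ L₀ = 2 * Real.pi * c :=
    ⟨L₀ / (2 * Real.pi), by positivity, by field_simp⟩
  obtain ⟨⟨γ, η⟩, hγη⟩ := SurfactantCurve.admissible_nonempty hL₀ hA₀
  obtain ⟨T, N, p, q, h, -⟩ :=
    SurfactantCurve.exists_tangentDirector_of_admissible (δ := δ) (lam := lam) hc hγη
  obtain ⟨T, N, p, q, h, hmin⟩ :=
    SurfactantCurve.exists_optimal_tangentDirector (δ := δ) hc hlam ⟨T, N, p, q, h⟩
  obtain ⟨r, hr, hre⟩ :=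
    SurfactantCurve.exists_admissible_of_tangentDirector (δ := δ) (lam := lam) hc h
  refine ⟨r, hr, fun s hs => ?_⟩
  obtain ⟨T', N', p', q', h', he'⟩ :=
    SurfactantCurve.exists_tangentDirector_of_admissible (δ := δ) (lam := lam) (γ := s.1)
      (η := s.2) hc hs
  change SurfactantCurve.energy δ lam r.1 r.2 ≤ SurfactantCurve.energy δ lam s.1 s.2
  rw [hre, ← he']
  exact hmin T' N' p' q' h'

end
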